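/- **Setting.** Let $\mathscr{H}$ be a linear space of real functions on a set $\Omega$ such that $\varphi(X_1,\dots,X_n)\in\mathscr{H}$ whenever $X_1,\dots,X_n\in\mathscr{H}$ and $\varphi\in C_{l,Lip}(\mathbb{R}^n)$, i.e. $|\varphi(x)-\varphi(y)|\le C(1+|x|^m+|y|^m)|x-y|$ for some $C>0$, $m\in\mathbb{N}$. Let $\mathbb{E}:\mathscr{H}\to[-\infty,\infty]$ be a sub-linear expectation: monotone, $\mathbb{E}[c]=c$, $\mathbb{E}[\lambda X]=\lambda\mathbb{E}[X]$ for $\lambda\ge 0$, and $\mathbb{E}[X+Y]\le\mathbb{E}[X]+\mathbb{E}[Y]$ whenever the right-hand side is not of the form $\infty-\infty$ or $-\infty+\infty$. Put $\mathcal{E}[X]=-\mathbb{E}[-X]$ and, for $A\subset\Omega$, $$\mathbb{V}(A)=\inf\{\mathbb{E}[\xi]: I_A\le\xi,\ \xi\in\mathscr{H}\},\qquad C_{\mathbb{V}}[X]=\int_0^\infty \mathbb{V}(X\ge t)\,dt+\int_{-\infty}^0[\mathbb{V}(X\ge t)-1]\,dt .$$ A sequence $\{X_n;n\ge1\}\subset\mathscr{H}$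 is i.i.d. if * (identical distribution) for every $n$ and $\varphi\in C_{l,Lip}(\mathbb{R})$, $\mathbb{E}[\varphi(X_n)]=\mathbb{E}[\varphi(X_1)]$ whenever both are finite; * (independence) for every $n\ge1$, with $\boldsymbol{X}=(X_1,\dots,X_n)$ and $Y=X_{n+1}$, one has $\mathbb{E}[\varphi(\boldsymbol{X},Y)]=\mathbb{E}\big[\mathbb{E}[\varphi(x,Y)]|_{x=\boldsymbol{X}}\big]$ for every $\varphi\in C_{l,Lip}(\mathbb{R}^n\times\mathbb{R})$ such that $\overline\varphi(x):=\mathbb{E}[|\varphi(x,Y)|]<\infty$ for all $x$, the functions $\overline\varphi(\boldsymbol{X})$ and $\mathbb{E}[\varphi(x,Y)]|_{x=\boldsymbol{X}}$ belong to $\mathscr{H}$, and $\mathbb{E}[\overline\varphi(\boldsymbol{X})]<\infty$. **Statement.** Suppose that $\mathscr{H}$ is a monotone class, i.e. $X\in\mathscr{H}$ whenever $X_n\in\mathscr{H}$ and $X_n\downarrow X\ge 0$ pointwise, and that $\mathbb{E}$ is continuous, i.e. for $X_n,X\in\mathscr{H}$: $\mathbb{E}[X_n]\uparrow\mathbb{E}[X]$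 if $0\le X_n\uparrow X$, and $\mathbb{E}[X_n]\downarrow\mathbb{E}[X]$ if $0\le X_n\downarrow X$ and $\mathbb{E}[X_1]<\infty$. Let $\{X_n;n\ge1\}$ be an i.i.d. sequence in $\mathscr{H}$ and $S_n=X_1+\dots+X_n$. Then 1. $\mathbb{V}\Big(\limsup_{n\to\infty}\frac{|S_n|}{n}=+\infty\Big)<1$ implies $C_{\mathbb{V}}[|X_1|]<\infty$; 2. $C_{\mathbb{V}}[|X_1|]<\infty$ implies $$\mathbb{V}\Big(\Big\{\liminf_{n\to\infty}\frac{S_n}{n}<\mathcal{E}[X_1]\Big\}\cup\Big\{\limsup_{n\to\infty}\frac{S_n}{n}>\mathbb{E}[X_1]\Big\}\Big)=0 .$$ -/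

import Mathlib

open Filter Topology MeasureTheory Set

noncomputable section

/-- The class `C_{l,Lip}` of locally Lipschitz functions with polynomial growth of the local
Lipschitz constant. (All norms on `ℝⁿ` give the same class.) -/
def LocLip {V : Type*} [NormedAddCommGroup V] (φ : V → ℝ) : Prop :=
  ∃ C : ℝ, 0 < C ∧ ∃ m : ℕ, ∀ x y : V,
    |φ x - φ y| ≤ C * (1 + ‖x‖ ^ m + ‖y‖ ^ m) * ‖x - y‖

/-- A sub-linear expectation space `(Ω, H, E)`. The functional `E` is extended-real valued; only
its values on `H` are ever constrained or used. -/
structure SublinearExpectation (Ω : Type*) where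
  /-- The linear space of random variables. -/
  H : Submodule ℝ (Ω → ℝ)
  /-- `H` is stable under composition with `C_{l,Lip}` functions of several variables. -/
  comp_mem : ∀ (n : ℕ) (X : Fin n → Ω → ℝ), (∀ i, X i ∈ H) →
    ∀ φ : (Fin n → ℝ) → ℝ, LocLip φ → (fun ω => φ (fun i => X i ω)) ∈ H
  /-- The upper expectation. -/
  E : (Ω → ℝ) → EReal
  mono : ∀ X ∈ H, ∀ Y ∈ H, Y ≤ X → E Y ≤ E X
  const : ∀ c : ℝ, E (fun _ => c) = (c : EReal)
  /-- Sub-additivity, whenever the right-hand side is not of the form `∞ - ∞` or `-∞ + ∞`. -/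
  subadd : ∀ X ∈ H, ∀ Y ∈ H, ¬(E X = ⊤ ∧ E Y = ⊥) → ¬(E X = ⊥ ∧ E Y = ⊤) →
    E (X + Y) ≤ E X + E Y
  homog : ∀ X ∈ H, ∀ r : ℝ, 0 ≤ r → E (r • X) = (r : EReal) * E X

namespace SublinearExpectation

variable {Ω : Type*} (S : SublinearExpectation Ω)

/-- The conjugate (lower) expectation `-E[-X]`. -/
def lowerE (X : Ω → ℝ) : EReal := -S.E (-X)

/-- `H` is a monotone class: `X ∈ H` whenever `H ∋ Xₙ ↓ X ≥ 0`. -/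
def IsMonotoneClass : Prop :=
  ∀ (Xs : ℕ → Ω → ℝ) (X : Ω → ℝ), (∀ n, Xs n ∈ S.H) → Antitone Xs →
    (∀ ω, Tendsto (fun n => Xs n ω) atTop (𝓝 (X ω))) → 0 ≤ X → X ∈ S.H

/-- Continuity from below: `E[Xₙ] ↑ E[X]` if `0 ≤ Xₙ ↑ X`, with `Xₙ, X ∈ H`. -/
def ContinuousFromBelow : Prop :=
  ∀ (Xs : ℕ → Ω → ℝ) (X : Ω → ℝ), (∀ n, Xs n ∈ S.H) → X ∈ S.H → (∀ n, 0 ≤ Xs n) →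
    Monotone Xs → (∀ ω, Tendsto (fun n => Xs n ω) atTop (𝓝 (X ω))) →
    Tendsto (fun n => S.E (Xs n)) atTop (𝓝 (S.E X))

/-- Continuity from above: `E[Xₙ] ↓ E[X]` if `0 ≤ Xₙ ↓ X`, with `Xₙ, X ∈ H` and the initial
expectation finite. (Without the finiteness, applying the condition to `X / n ↓ 0` would force
`E[X] < ∞` for all `0 ≤ X ∈ H`; so the condition here is the weaker one, and agrees with the one
without finiteness when `E` is finite on `H`.) -/
def ContinuousFromAbove : Prop :=
  ∀ (Xs : ℕ → Ω → ℝ) (X : Ω → ℝ), (∀ n, Xs n ∈ S.H) → X ∈ S.H → (∀ n, 0 ≤ Xs n) →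
    Antitone Xs → (∀ ω, Tendsto (fun n => Xs n ω) atTop (𝓝 (X ω))) → S.E (Xs 0) < ⊤ →
    Tendsto (fun n => S.E (Xs n)) atTop (𝓝 (S.E X))

/-- A continuous sub-linear expectation. -/
def IsContinuous : Prop := S.ContinuousFromBelow ∧ S.ContinuousFromAbove

/-- Identical distribution of two random variables: `E[φ(X)] = E[φ(Y)]` for all
`φ ∈ C_{l,Lip}(ℝ)` for which both are finite. -/
def IdentDistrib (X Y : Ω → ℝ) : Prop :=
  ∀ φ : ℝ → ℝ, LocLip φ →
    S.E (fun ω => φ (X ω)) ≠ ⊤ → S.E (fun ω => φ (X ω)) ≠ ⊥ →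
    S.E (fun ω => φ (Y ω)) ≠ ⊤ → S.E (fun ω => φ (Y ω)) ≠ ⊥ →
    S.E (fun ω => φ (X ω)) = S.E (fun ω => φ (Y ω))

/-- `Y` is independent to the random vector `X`:
`E[φ(X, Y)] = E[E[φ(x, Y)]|_{x = X}]` for all `φ ∈ C_{l,Lip}` such that
`φ̄(x) := E[|φ(x, Y)|] < ∞` for all `x` and `E[φ̄(X)] < ∞`, the functions `φ̄(X)` and
`E[φ(x, Y)]|_{x = X}` being in the domain `H` of `E`.
(If `φ̄` is finite then `E[φ(x, Y)]` is finite as well, so no `toReal` loses information.) -/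
def IndepTo {m : ℕ} (Y : Ω → ℝ) (X : Fin m → Ω → ℝ) : Prop :=
  ∀ φ : (Fin m → ℝ) × ℝ → ℝ, LocLip φ →
    (∀ x : Fin m → ℝ, S.E (fun ω => |φ (x, Y ω)|) < ⊤) →
    (fun ω => (S.E (fun ω' => |φ (fun i => X i ω, Y ω')|)).toReal) ∈ S.H →
    S.E (fun ω => (S.E (fun ω' => |φ (fun i => X i ω, Y ω')|)).toReal) < ⊤ →
    (fun ω => (S.E (fun ω' => φ (fun i => X i ω, Y ω'))).toReal) ∈ S.H →
    S.E (fun ω => φ (fun i => X i ω, Y ω)) =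
      S.E (fun ω => (S.E (fun ω' => φ (fun i => X i ω, Y ω'))).toReal)

/-- A sequence of independent and identically distributed random variables in `H`
(indexed from `0`). -/
structure IsIID (X : ℕ → Ω → ℝ) : Prop where
  mem : ∀ n, X n ∈ S.H
  indep : ∀ n, S.IndepTo (X (n + 1)) (fun k : Fin (n + 1) => X k)
  identDistrib : ∀ n, S.IdentDistrib (X n) (X 0)

/-- The capacity generated by `E`: `V(A) = inf {E[ξ] : 1_A ≤ ξ, ξ ∈ H}`. -/
def capacity (A : Set Ω) : EReal :=
  sInf {e : EReal | ∃ ξ ∈ S.H, A.indicator (fun _ => (1 : ℝ)) ≤ ξ ∧ e = S.E ξ}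

/-- The Choquet integral with respect to the capacity `V`:
`∫₀^∞ V(X ≥ t) dt + ∫_{-∞}^0 [V(X ≥ t) - 1] dt`. Since `0 ≤ V ≤ 1`, nothing is truncated. -/
def choquet (X : Ω → ℝ) : EReal :=
  ((∫⁻ t in Ioi (0 : ℝ), (S.capacity {ω | t ≤ X ω}).toENNReal : ENNReal) : EReal) -
    ((∫⁻ t in Iio (0 : ℝ), (1 - (S.capacity {ω | t ≤ X ω}).toENNReal) : ENNReal) : EReal)

end SublinearExpectation

/-- The partial sum of the first `n` variables. -/
def partialSum {Ω : Type*} (X : ℕ → Ω → ℝ) (n : ℕ) (ω : Ω) : ℝ :=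
  ∑ k ∈ Finset.range n, X k ω

end

/-! On a monotone class, continuity from below makes the capacity countably subadditive, so it is an
outer measure (`capOuter`) and the first Borel–Cantelli lemma holds quasi-surely. Independence and
identical distribution are used only for bounded Lipschitz test functions, whose side conditions are
automatic.

Part 1 is a second Borel–Cantelli argument. If the Choquet integral is infinite, smooth versions `f
m k` of the indicator of `|x| ≥ (m+1)(k+1)`, `k ≥ m`, have divergent sums of expectations.
Independence gives `E[1 - ∏(1 - f)] = 1 - ∏(1 - E f)`, which tends to `1`
(`IsIID.tendsto_Ev_one_sub_prod`). Letting the number of factors grow (continuity from below) and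
then `m` (continuity from above) produces a function of expectation `1` bounded by the indicator of
`limsup |S_n|/n = ∞`, since jumps of size `(m+1)(k+1)` for every `m` force that event. Its capacity
is then `1`.

Part 2 follows Etemadi's subsequence method, one side at a time. The variables `± X_k` are truncated
above at `k + 1` and below at a fixed `-c`, then recentred to have nonpositive upper expectation.
With no additive variance available, the square of the positive part of the sum serves instead: its
cross terms have nonnegative coefficients, hence nonpositive upper expectation
(`IsIID.Ev_max_sum_sq_le`). Chebyshev and Borel–Cantelli give convergence along `⌊c^j⌋`; the lower
bound on the increments fills the gaps (`tendsto_max_div_of_floor_pow`). Finiteness of the Choquet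
integral makes the truncation at `k + 1` eventually inactive and the second moments summable. The
recentring error `E[(|X| - c)⁺]` vanishes as `c → ∞`. -/

/-! ### Bounded Lipschitz test functions. -/

/-- Bounded Lipschitz functions. -/
structure BoundedLip {V : Type*} [NormedAddCommGroup V] (φ : V → ℝ) : Prop where
  lip : ∃ K, LipschitzWith K φ
  bdd : ∃ C, ∀ x, |φ x| ≤ C

theorem LipschitzWith.locLip {V : Type*} [NormedAddCommGroup V] {φ : V → ℝ} {K : NNReal}
    (h : LipschitzWith K φ) : LocLip φ := by
  refine ⟨K + 1, by positivity, 0, fun x y => ?_⟩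
  have h1 := h.dist_le_mul x y
  rw [Real.dist_eq, dist_eq_norm] at h1
  refine h1.trans ?_
  have hK : (0 : ℝ) ≤ K := K.2
  simp only [pow_zero]
  gcongr
  linarith

namespace BoundedLip

variable {V W : Type*} [NormedAddCommGroup V] [NormedAddCommGroup W] {φ ψ : V → ℝ}

theorem locLip (h : BoundedLip φ) : LocLip φ := let ⟨_, hK⟩ := h.lip; hK.locLip

theorem const (c : ℝ) : BoundedLip (fun _ : V => c) :=
  ⟨⟨0, LipschitzWith.const c⟩, |c|, fun _ => le_rfl⟩

theorem add (h : BoundedLip φ) (h' : BoundedLip ψ) : BoundedLip (fun x => φ x + ψ x) := by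
  obtain ⟨⟨K, hK⟩, C, hC⟩ := h
  obtain ⟨⟨K', hK'⟩, C', hC'⟩ := h'
  exact ⟨⟨_, hK.add hK'⟩, C + C', fun x => (abs_add_le _ _).trans (add_le_add (hC x) (hC' x))⟩

theorem neg (h : BoundedLip φ) : BoundedLip (fun x => -φ x) := by
  obtain ⟨⟨K, hK⟩, C, hC⟩ := h
  exact ⟨⟨_, hK.neg⟩, C, fun x => by simpa using hC x⟩

theorem sub (h : BoundedLip φ) (h' : BoundedLip ψ) : BoundedLip (fun x => φ x - ψ x) := by
  simpa only [sub_eq_add_neg] using h.add h'.neg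

theorem mul (h : BoundedLip φ) (h' : BoundedLip ψ) : BoundedLip (fun x => φ x * ψ x) := by
  obtain ⟨⟨K, hK⟩, C, hC⟩ := h
  obtain ⟨⟨K', hK'⟩, C', hC'⟩ := h'
  have hC0 : 0 ≤ C := (abs_nonneg _).trans (hC 0)
  have hC0' : 0 ≤ C' := (abs_nonneg _).trans (hC' 0)
  refine ⟨⟨C.toNNReal * K' + C'.toNNReal * K, LipschitzWith.of_dist_le_mul fun x y => ?_⟩,
    C * C', fun x => ?_⟩
  · have h1 := hK.dist_le_mul x y
    have h2 := hK'.dist_le_mul x y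
    rw [Real.dist_eq] at h1 h2 ⊢
    have e : φ x * ψ x - φ y * ψ y = φ x * (ψ x - ψ y) + ψ y * (φ x - φ y) := by ring
    rw [e]
    push_cast [Real.coe_toNNReal _ hC0, Real.coe_toNNReal _ hC0']
    calc _ ≤ |φ x| * |ψ x - ψ y| + |ψ y| * |φ x - φ y| := by
          rw [← abs_mul, ← abs_mul]; exact abs_add_le _ _
      _ ≤ C * (K' * dist x y) + C' * (K * dist x y) := by
          gcongr
          exacts [hC x, hC' y]
      _ = _ := by ring
  · rw [abs_mul]
    exact mul_le_mul (hC x) (hC' x) (abs_nonneg _) hC0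

theorem sq (h : BoundedLip φ) : BoundedLip (fun x => φ x ^ 2) := by
  simpa only [pow_two] using h.mul h

theorem sum {ι : Type*} (s : Finset ι) {f : ι → V → ℝ} (h : ∀ i ∈ s, BoundedLip (f i)) :
    BoundedLip (fun x => ∑ i ∈ s, f i x) := by
  classical
  induction s using Finset.induction_on with
  | empty => simpa using const 0
  | insert a s ha ih =>
    simp only [Finset.sum_insert ha]
    exact (h a (by simp)).add (ih fun i hi => h i (by simp [hi]))

theorem prod {ι : Type*} (s : Finset ι) {f : ι → V → ℝ} (h : ∀ i ∈ s, BoundedLip (f i)) :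
    BoundedLip (fun x => ∏ i ∈ s, f i x) := by
  classical
  induction s using Finset.induction_on with
  | empty => simpa using const 1
  | insert a s ha ih =>
    simp only [Finset.prod_insert ha]
    exact (h a (by simp)).mul (ih fun i hi => h i (by simp [hi]))

theorem comp (h : BoundedLip φ) {g : W → V} {K : NNReal} (hg : LipschitzWith K g) :
    BoundedLip (fun x => φ (g x)) := by
  obtain ⟨⟨K', hK⟩, C, hC⟩ := h
  exact ⟨⟨_, hK.comp hg⟩, C, fun x => hC _⟩

theorem abs (h : BoundedLip φ) : BoundedLip (fun x => |φ x|) := by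
  obtain ⟨⟨K, hK⟩, C, hC⟩ := h
  exact ⟨⟨_, (lipschitzWith_one_norm (E := ℝ)).comp hK⟩, C, fun x => by simpa using hC x⟩

theorem max_zero (h : BoundedLip φ) : BoundedLip (fun x => max (φ x) 0) := by
  obtain ⟨⟨K, hK⟩, C, hC⟩ := h
  refine ⟨⟨_, hK.max_const 0⟩, C, fun x => ?_⟩
  rw [abs_of_nonneg (le_max_right _ _)]
  exact max_le ((le_abs_self _).trans (hC x)) ((abs_nonneg _).trans (hC x))

end BoundedLip

/-- Truncation of `x` to the interval `[a, b]`. -/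
def clamp (a b x : ℝ) : ℝ := max a (min x b)

theorem lipschitzWith_clamp (a b : ℝ) : LipschitzWith 1 (clamp a b) :=
  (LipschitzWith.id.min_const b).const_max a

theorem clamp_mem {a b : ℝ} (h : a ≤ b) (x : ℝ) : clamp a b x ∈ Icc a b :=
  ⟨le_max_left _ _, max_le h (min_le_right _ _)⟩

theorem boundedLip_clamp {a b : ℝ} (h : a ≤ b) : BoundedLip (clamp a b) := by
  refine ⟨⟨1, lipschitzWith_clamp a b⟩, max |a| |b|, fun x => ?_⟩
  exact abs_le_max_abs_abs (clamp_mem h x).1 (clamp_mem h x).2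

/-! ### Real-valued calculus of the upper expectation on integrable variables. -/

namespace SublinearExpectation

variable {Ω : Type*} (S : SublinearExpectation Ω) {X Y : Ω → ℝ}

theorem comp_mem_one (hX : X ∈ S.H) {φ : ℝ → ℝ} {K : NNReal} (hφ : LipschitzWith K φ) :
    (fun ω => φ (X ω)) ∈ S.H :=
  S.comp_mem 1 (fun _ => X) (fun _ => hX) (fun x => φ (x 0))
    (hφ.comp (LipschitzWith.eval (α := fun _ : Fin 1 => ℝ) 0)).locLip

theorem const_mem (c : ℝ) : (fun _ : Ω => c) ∈ S.H :=
  S.comp_mem 0 (fun _ _ => 0) (fun i => i.elim0) (fun _ => c) (BoundedLip.const c).locLip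

theorem abs_mem (hX : X ∈ S.H) : (fun ω => |X ω|) ∈ S.H :=
  S.comp_mem_one hX (lipschitzWith_one_norm (E := ℝ))

theorem E_zero : S.E 0 = 0 := S.const 0

theorem E_nonneg (hX : X ∈ S.H) (h : 0 ≤ X) : 0 ≤ S.E X := by
  rw [← S.E_zero]; exact S.mono _ hX _ S.H.zero_mem h

/-- Integrable elements of `H`. -/
def L1 (X : Ω → ℝ) : Prop := X ∈ S.H ∧ S.E (fun ω => |X ω|) < ⊤

/-- The real value of the upper expectation. -/
noncomputable def Ev (X : Ω → ℝ) : ℝ := (S.E X).toReal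

variable {S}

namespace L1

theorem mono (hY : S.L1 Y) (hX : X ∈ S.H) (h : ∀ ω, |X ω| ≤ |Y ω|) : S.L1 X :=
  ⟨hX, (S.mono _ (S.abs_mem hY.1) _ (S.abs_mem hX) h).trans_lt hY.2⟩

theorem of_bdd (hX : X ∈ S.H) {C : ℝ} (h : ∀ ω, |X ω| ≤ C) : S.L1 X :=
  ⟨hX, (S.mono _ (S.const_mem C) _ (S.abs_mem hX) h).trans_lt
    (by rw [S.const]; exact EReal.coe_lt_top _)⟩

theorem const (c : ℝ) : S.L1 (fun _ => c) := of_bdd (S.const_mem c) fun _ => le_rfl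

theorem add (hX : S.L1 X) (hY : S.L1 Y) : S.L1 (fun ω => X ω + Y ω) := by
  refine ⟨S.H.add_mem hX.1 hY.1, ?_⟩
  have h0X := S.E_nonneg (S.abs_mem hX.1) fun ω => abs_nonneg _
  have h0Y := S.E_nonneg (S.abs_mem hY.1) fun ω => abs_nonneg _
  refine ((S.mono _ (S.H.add_mem (S.abs_mem hX.1) (S.abs_mem hY.1)) _
    (S.abs_mem (S.H.add_mem hX.1 hY.1)) fun ω => abs_add_le _ _).trans
    (S.subadd _ (S.abs_mem hX.1) _ (S.abs_mem hY.1) (fun h => ?_) fun h => ?_)).trans_lt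
    (EReal.add_lt_top hX.2.ne hY.2.ne)
  · exact hX.2.ne h.1
  · exact hY.2.ne h.2

theorem neg (hX : S.L1 X) : S.L1 (fun ω => -X ω) :=
  hX.mono (S.H.neg_mem hX.1) fun ω => by simp

theorem const_mul (hX : S.L1 X) (c : ℝ) : S.L1 (fun ω => c * X ω) := by
  refine ⟨S.H.smul_mem c hX.1, ?_⟩
  have h := S.homog _ (S.abs_mem hX.1) |c| (abs_nonneg c)
  have e : (fun ω => |c * X ω|) = |c| • fun ω => |X ω| := by ext ω; simp [abs_mul]
  rw [e, h]
  have h0X := S.E_nonneg (S.abs_mem hX.1) fun ω => abs_nonneg _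
  have h1 := hX.2
  lift S.E (fun ω => |X ω|) to ℝ using ⟨h1.ne, (EReal.bot_lt_zero.trans_le h0X).ne'⟩ with r
  rw [← EReal.coe_mul]
  exact EReal.coe_lt_top _

theorem abs (hX : S.L1 X) : S.L1 (fun ω => |X ω|) := hX.mono (S.abs_mem hX.1) fun ω => by simp

theorem comp (hX : S.L1 X) {φ : ℝ → ℝ} (hφ : LipschitzWith 1 φ) : S.L1 (fun ω => φ (X ω)) := by
  refine (hX.abs.add (const |φ 0|)).mono (S.comp_mem_one hX.1 hφ) fun ω => ?_
  have h := hφ.dist_le_mul (X ω) 0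
  simp only [Real.dist_eq, NNReal.coe_one, one_mul, sub_zero] at h
  rw [abs_of_nonneg (by positivity : 0 ≤ |X ω| + |φ 0|)]
  have := abs_sub_abs_le_abs_sub (φ (X ω)) (φ 0)
  linarith

theorem sum {ι : Type*} (s : Finset ι) {f : ι → Ω → ℝ} (h : ∀ i ∈ s, S.L1 (f i)) :
    S.L1 (fun ω => ∑ i ∈ s, f i ω) := by
  classical
  induction s using Finset.induction_on with
  | empty => simpa using const (S := S) 0
  | insert a s ha ih =>
    simp only [Finset.sum_insert ha]
    exact (h a (by simp)).add (ih fun i hi => h i (by simp [hi]))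

/-- Both `E X` and `E (-X)` are below `⊤`; if `E X` were `⊥`, subadditivity applied to `X + (-X) =
0` would give `0 ≤ ⊥`. -/
theorem coe_Ev (hX : S.L1 X) : (S.Ev X : EReal) = S.E X := by
  have hle {Z} (hZ : S.L1 Z) : S.E Z < ⊤ :=
    (S.mono _ (S.abs_mem hZ.1) _ hZ.1 fun ω => le_abs_self _).trans_lt hZ.2
  have h1 := hle hX
  have h2 : S.E (-X) < ⊤ := hle hX.neg
  refine EReal.coe_toReal h1.ne fun hb => ?_
  have h3 := S.subadd X hX.1 (-X) (S.H.neg_mem hX.1) (fun h => h1.ne h.1) fun h => h2.ne h.2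
  rw [hb, add_neg_cancel, S.E_zero, EReal.bot_add] at h3
  simp at h3

end L1

theorem Ev_mono (hX : S.L1 X) (hY : S.L1 Y) (h : ∀ ω, X ω ≤ Y ω) : S.Ev X ≤ S.Ev Y := by
  rw [← EReal.coe_le_coe_iff, hX.coe_Ev, hY.coe_Ev]
  exact S.mono _ hY.1 _ hX.1 h

@[simp] theorem Ev_const (c : ℝ) : S.Ev (fun _ => c) = c := by simp [Ev, S.const]

theorem Ev_add_le (hX : S.L1 X) (hY : S.L1 Y) : S.Ev (fun ω => X ω + Y ω) ≤ S.Ev X + S.Ev Y := by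
  rw [← EReal.coe_le_coe_iff, (hX.add hY).coe_Ev, EReal.coe_add, hX.coe_Ev, hY.coe_Ev]
  refine S.subadd X hX.1 Y hY.1 (fun h => ?_) fun h => ?_
  · rw [← hX.coe_Ev] at h; exact EReal.coe_ne_top _ h.1
  · rw [← hX.coe_Ev] at h; exact EReal.coe_ne_bot _ h.1

theorem Ev_const_mul (hX : S.L1 X) {c : ℝ} (hc : 0 ≤ c) :
    S.Ev (fun ω => c * X ω) = c * S.Ev X := by
  rw [← EReal.coe_eq_coe_iff, (hX.const_mul c).coe_Ev, EReal.coe_mul, hX.coe_Ev]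
  exact S.homog X hX.1 c hc

theorem Ev_add_const (hX : S.L1 X) (c : ℝ) : S.Ev (fun ω => X ω + c) = S.Ev X + c := by
  refine le_antisymm (by simpa using Ev_add_le hX (L1.const c)) ?_
  have := Ev_add_le (hX.add (L1.const c)) (L1.const (S := S) (-c))
  simp only [Ev_const, add_neg_cancel_right] at this
  linarith

theorem Ev_nonneg (hX : S.L1 X) (h : ∀ ω, 0 ≤ X ω) : 0 ≤ S.Ev X := by
  simpa using Ev_mono (L1.const 0) hX h

theorem Ev_le_const (hX : S.L1 X) {c : ℝ} (h : ∀ ω, X ω ≤ c) : S.Ev X ≤ c := by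
  simpa using Ev_mono hX (L1.const c) h

theorem Ev_sum_le {ι : Type*} (s : Finset ι) {f : ι → Ω → ℝ} (h : ∀ i ∈ s, S.L1 (f i)) :
    S.Ev (fun ω => ∑ i ∈ s, f i ω) ≤ ∑ i ∈ s, S.Ev (f i) := by
  classical
  induction s using Finset.induction_on with
  | empty => simp
  | insert a s ha ih =>
    simp only [Finset.sum_insert ha]
    have h' : ∀ i ∈ s, S.L1 (f i) := fun i hi => h i (by simp [hi])
    exact (Ev_add_le (h a (by simp)) (L1.sum s h')).trans (by gcongr; exact ih h')

theorem abs_Ev_sub_le (hX : S.L1 X) (hY : S.L1 Y) {c : ℝ} (h : ∀ ω, |X ω - Y ω| ≤ c) :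
    |S.Ev X - S.Ev Y| ≤ c := by
  have h1 := Ev_mono hX (hY.add (L1.const c)) fun ω => by linarith [(abs_le.1 (h ω)).2]
  have h2 := Ev_mono hY (hX.add (L1.const c)) fun ω => by linarith [(abs_le.1 (h ω)).1]
  rw [Ev_add_const hY] at h1
  rw [Ev_add_const hX] at h2
  rw [abs_le]; constructor <;> linarith

theorem BoundedLip_L1 {m : ℕ} {X : Fin m → Ω → ℝ} (hX : ∀ i, X i ∈ S.H) {φ : (Fin m → ℝ) → ℝ}
    (hφ : BoundedLip φ) : S.L1 (fun ω => φ fun i => X i ω) :=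
  let ⟨_, hC⟩ := hφ.bdd
  L1.of_bdd (S.comp_mem m X hX φ hφ.locLip) fun _ => hC _

theorem BoundedLip_L1_one (hX : X ∈ S.H) {φ : ℝ → ℝ} (hφ : BoundedLip φ) :
    S.L1 (fun ω => φ (X ω)) :=
  let ⟨_, hC⟩ := hφ.bdd
  let ⟨_, hK⟩ := hφ.lip
  L1.of_bdd (S.comp_mem_one hX hK) fun _ => hC _

/-- The upper expectation is 1-Lipschitz for the sup norm, so partial integration preserves the
class. This supplies the membership conditions in `IndepTo`. -/
theorem boundedLip_Ev {V : Type*} [NormedAddCommGroup V] (hY : Y ∈ S.H) {φ : V × ℝ → ℝ}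
    (hφ : BoundedLip φ) : BoundedLip (fun x => S.Ev fun ω => φ (x, Y ω)) := by
  have hL : ∀ x, S.L1 fun ω => φ (x, Y ω) := fun x =>
    BoundedLip_L1_one hY (hφ.comp (LipschitzWith.prodMk_left x))
  obtain ⟨⟨K, hK⟩, C, hC⟩ := hφ
  refine ⟨⟨K, LipschitzWith.of_dist_le_mul fun x y => ?_⟩, C, fun x => ?_⟩
  · refine abs_Ev_sub_le (hL x) (hL y) fun ω => ?_
    have := hK.dist_le_mul (x, Y ω) (y, Y ω)
    simpa [Real.dist_eq, Prod.dist_eq] using this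
  · have := abs_Ev_sub_le (hL x) (L1.const (S := S) 0) (c := C) fun ω => by simpa using hC _
    simpa using this

theorem IndepTo.Ev_eq {m : ℕ} {X : Fin m → Ω → ℝ} (h : S.IndepTo Y X) (hX : ∀ i, X i ∈ S.H)
    (hY : Y ∈ S.H) {φ : (Fin m → ℝ) × ℝ → ℝ} (hφ : BoundedLip φ) :
    S.Ev (fun ω => φ (fun i => X i ω, Y ω)) =
      S.Ev (fun ω => S.Ev fun ω' => φ (fun i => X i ω, Y ω')) := by
  have h1 := BoundedLip_L1 hX (boundedLip_Ev hY hφ)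
  have h2 := BoundedLip_L1 hX (boundedLip_Ev hY hφ.abs)
  have h3 : ∀ x, S.L1 fun ω => φ (x, Y ω) := fun x =>
    BoundedLip_L1_one hY (hφ.comp (LipschitzWith.prodMk_left x))
  rw [Ev, h φ hφ.locLip (fun x => (h3 x).2) h2.1 ?_ h1.1]
  · rfl
  · have := h2.coe_Ev
    exact this ▸ EReal.coe_lt_top _

namespace IsIID

variable {X : ℕ → Ω → ℝ}

theorem Ev_comp_eq (hX : S.IsIID X) (n : ℕ) {φ : ℝ → ℝ} (hφ : BoundedLip φ) :
    S.Ev (fun ω => φ (X n ω)) = S.Ev (fun ω => φ (X 0 ω)) := by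
  have h n := (BoundedLip_L1_one (hX.mem n) hφ).coe_Ev
  rw [Ev, Ev, hX.identDistrib n φ hφ.locLip] <;> rw [← h] <;> simp

theorem Ev_prod_eq (hX : S.IsIID X) (n : ℕ) {φ : (Fin (n + 1) → ℝ) × ℝ → ℝ} (hφ : BoundedLip φ) :
    S.Ev (fun ω => φ (fun i => X i ω, X (n + 1) ω)) =
      S.Ev (fun ω => S.Ev fun ω' => φ (fun i => X i ω, X (n + 1) ω')) :=
  (hX.indep n).Ev_eq (fun i => hX.mem i) (hX.mem _) hφ

end IsIID

end SublinearExpectation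

/-! ### The capacity as an outer measure, and the Choquet integral. -/

theorem EReal.toENNReal_one : EReal.toENNReal 1 = 1 := by
  rw [← EReal.coe_one, EReal.toENNReal_of_ne_top (EReal.coe_ne_top 1)]
  simp

namespace SublinearExpectation

variable {Ω : Type*} {S : SublinearExpectation Ω} {X Y : Ω → ℝ}

theorem capacity_le {A : Set Ω} (hX : X ∈ S.H) (h0 : ∀ ω, 0 ≤ X ω) (h : ∀ ω ∈ A, 1 ≤ X ω) :
    S.capacity A ≤ S.E X :=
  sInf_le ⟨X, hX, Set.indicator_le' h fun ω _ => h0 ω, rfl⟩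

variable (S) in
theorem capacity_nonneg (A : Set Ω) : 0 ≤ S.capacity A := by
  refine le_sInf ?_
  rintro e ⟨ξ, hξ, h, rfl⟩
  exact S.E_nonneg hξ fun ω => (Set.indicator_nonneg (by simp) ω).trans (h ω)

variable (S) in
theorem capacity_mono {A B : Set Ω} (h : A ⊆ B) : S.capacity A ≤ S.capacity B := by
  refine sInf_le_sInf ?_
  rintro e ⟨ξ, hξ, h', rfl⟩
  exact ⟨ξ, hξ, (Set.indicator_le_indicator_of_subset h fun _ => zero_le_one).trans h', rfl⟩

theorem le_capacity {A : Set Ω} (hX : X ∈ S.H) (h1 : ∀ ω, X ω ≤ 1) (h0 : ∀ ω ∉ A, X ω ≤ 0) :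
    S.E X ≤ S.capacity A := by
  refine le_sInf ?_
  rintro e ⟨ξ, hξ, h, rfl⟩
  refine S.mono _ hξ _ hX fun ω => ?_
  refine le_trans ?_ (h ω)
  by_cases hω : ω ∈ A
  · simpa [hω] using h1 ω
  · simpa [hω] using h0 ω hω

theorem exists_lt_of_capacity_lt {A : Set Ω} {r : EReal} (h : S.capacity A < r) :
    ∃ ξ ∈ S.H, (∀ ω, 0 ≤ ξ ω) ∧ (∀ ω ∈ A, 1 ≤ ξ ω) ∧ S.E ξ < r := by
  obtain ⟨e, ⟨ξ, hξ, h', rfl⟩, hr⟩ := sInf_lt_iff.1 h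
  refine ⟨ξ, hξ, fun ω => ?_, fun ω hω => ?_, hr⟩
  · exact (Set.indicator_nonneg (by simp) ω).trans (h' ω)
  · simpa [hω] using h' ω

variable (S) in
theorem capacity_le_one (A : Set Ω) : S.capacity A ≤ 1 := by
  simpa [S.const] using capacity_le (A := A) (S.const_mem 1) (by simp) (by simp)

variable (S) in
theorem capacity_univ : S.capacity univ = 1 := by
  refine (S.capacity_le_one _).antisymm ?_
  simpa [S.const] using le_capacity (A := univ) (S.const_mem 1) (by simp) (by simp)

theorem IsMonotoneClass.mem_of_monotone (hm : S.IsMonotoneClass) {Xs : ℕ → Ω → ℝ}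
    (h : ∀ n, Xs n ∈ S.H) (hmono : Monotone Xs) {c : ℝ} (hc : ∀ n ω, Xs n ω ≤ c)
    (hlim : ∀ ω, Tendsto (fun n => Xs n ω) atTop (𝓝 (X ω))) : X ∈ S.H := by
  have := hm (fun n ω => c - Xs n ω) (fun ω => c - X ω)
    (fun n => S.H.sub_mem (S.const_mem c) (h n))
    (fun m n hmn ω => sub_le_sub_left (hmono hmn ω) c)
    (fun ω => (hlim ω).const_sub c)
    (fun ω => sub_nonneg.2 (le_of_tendsto' (hlim ω) fun n => hc n ω))
  have h' := S.H.sub_mem (S.const_mem c) this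
  convert h' using 1
  ext ω
  simp

/-- Near-optimal majorants `ξ i`, with summable errors `δ i`, are glued into the supremum of `min (∑
ξ i) 1`. Capping at `1` keeps the limit in `H` and still dominates the indicator of the union;
continuity from below bounds its expectation. -/
theorem capacity_iUnion_le (hm : S.IsMonotoneClass) (hc : S.ContinuousFromBelow)
    (A : ℕ → Set Ω) :
    (S.capacity (⋃ i, A i)).toENNReal ≤ ∑' i, (S.capacity (A i)).toENNReal := by
  have hfin : ∀ i, (S.capacity (A i)).toENNReal ≠ ⊤ := fun i h => by
    have := (S.capacity_le_one (A i))
    rw [EReal.toENNReal_eq_top_iff] at h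
    rw [h] at this
    exact absurd this (by decide)
  refine ENNReal.le_of_forall_pos_le_add fun ε hε _ => ?_
  obtain ⟨δ, hδ0, hδ⟩ := ENNReal.exists_pos_sum_of_countable' (ENNReal.coe_pos.2 hε).ne' ℕ
  have hex : ∀ i, ∃ ξ, S.L1 ξ ∧ (∀ ω, 0 ≤ ξ ω) ∧ (∀ ω ∈ A i, 1 ≤ ξ ω) ∧
      ENNReal.ofReal (S.Ev ξ) ≤ (S.capacity (A i)).toENNReal + δ i := fun i => by
    have hlt : S.capacity (A i) < ((S.capacity (A i)).toENNReal + δ i : ENNReal) := by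
      nth_rw 1 [← EReal.coe_toENNReal (S.capacity_nonneg (A i))]
      exact EReal.coe_ennreal_lt_coe_ennreal_iff.2
        (ENNReal.lt_add_right (hfin i) (hδ0 i).ne')
    obtain ⟨ξ, hξ, h0, h1, hlt'⟩ := exists_lt_of_capacity_lt hlt
    have hL : S.L1 ξ := by
      refine ⟨hξ, ?_⟩
      have e : (fun ω => |ξ ω|) = ξ := by ext ω; exact abs_of_nonneg (h0 ω)
      rw [e]
      exact hlt'.trans_le le_top
    refine ⟨ξ, hL, h0, h1, ?_⟩
    rw [← hL.coe_Ev] at hlt'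
    rw [← EReal.coe_ennreal_le_coe_ennreal_iff, EReal.coe_ennreal_ofReal,
      max_eq_left (Ev_nonneg hL h0)]
    exact hlt'.le
  choose ξ hL h0 h1 hE using hex
  set η : ℕ → Ω → ℝ := fun n ω => min (∑ i ∈ Finset.range n, ξ i ω) 1 with hη
  have hsumL : ∀ n, S.L1 (fun ω => ∑ i ∈ Finset.range n, ξ i ω) := fun n =>
    L1.sum _ fun i _ => hL i
  have hηL : ∀ n, S.L1 (η n) := fun n =>
    (hsumL n).comp (φ := fun x => min x 1) (LipschitzWith.id.min_const 1)
  have hηmono : Monotone η := fun m n hmn ω => min_le_min_right _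
    (Finset.sum_le_sum_of_subset_of_nonneg (Finset.range_subset_range.2 hmn) fun i _ _ => h0 i ω)
  have hη1 : ∀ n ω, η n ω ≤ 1 := fun n ω => min_le_right _ _
  have hη0 : ∀ n ω, 0 ≤ η n ω := fun n ω =>
    le_min (Finset.sum_nonneg fun i _ => h0 i ω) zero_le_one
  have hlim : ∀ ω, Tendsto (fun n => η n ω) atTop (𝓝 (⨆ n, η n ω)) := fun ω =>
    tendsto_atTop_ciSup (fun m n hmn => hηmono hmn ω) ⟨1, by rintro _ ⟨n, rfl⟩; exact hη1 n ω⟩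
  have hmem : (fun ω => ⨆ n, η n ω) ∈ S.H :=
    hm.mem_of_monotone (fun n => (hηL n).1) hηmono hη1 hlim
  have hle : ∀ n ω, η n ω ≤ ⨆ n, η n ω := fun n ω =>
    le_ciSup (f := fun n => η n ω) ⟨1, by rintro _ ⟨n, rfl⟩; exact hη1 n ω⟩ n
  have hcap : S.capacity (⋃ i, A i) ≤ S.E (fun ω => ⨆ n, η n ω) := by
    refine capacity_le hmem (fun ω => (hη0 0 ω).trans (hle 0 ω)) fun ω hω => ?_
    obtain ⟨i, hi⟩ := mem_iUnion.1 hω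
    refine le_trans (le_min ?_ le_rfl) (hle (i + 1) ω)
    exact (h1 i ω hi).trans (Finset.single_le_sum (f := fun i => ξ i ω) (fun i _ => h0 i ω)
      (Finset.self_mem_range_succ i))
  have hEle : S.E (fun ω => ⨆ n, η n ω) ≤
      ((∑' i, ((S.capacity (A i)).toENNReal + δ i) : ENNReal) : EReal) := by
    refine le_of_tendsto' (hc η _ (fun n => (hηL n).1) hmem hη0 hηmono hlim) fun n => ?_
    rw [← (hηL n).coe_Ev]
    have h2 : S.Ev (η n) ≤ ∑ i ∈ Finset.range n, S.Ev (ξ i) :=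
      (Ev_mono (hηL n) (hsumL n) fun ω => min_le_left _ _).trans (Ev_sum_le _ fun i _ => hL i)
    refine (EReal.coe_le_coe_iff.2 h2).trans ?_
    rw [← max_eq_left (Finset.sum_nonneg fun i _ => Ev_nonneg (hL i) (h0 i)),
      ← EReal.coe_ennreal_ofReal, ENNReal.ofReal_sum_of_nonneg fun i _ => Ev_nonneg (hL i) (h0 i)]
    exact EReal.coe_ennreal_le_coe_ennreal_iff.2
      ((Finset.sum_le_sum fun i _ => hE i).trans (ENNReal.sum_le_tsum _))
  have h3 := EReal.toENNReal_le_toENNReal (hcap.trans hEle)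
  rw [EReal.toENNReal_coe, ENNReal.tsum_add] at h3
  exact h3.trans (by gcongr)

/-- The capacity of a continuous sub-linear expectation on a monotone class is an outer measure. -/
noncomputable def capOuter (hm : S.IsMonotoneClass) (hc : S.IsContinuous) : OuterMeasure Ω where
  measureOf A := (S.capacity A).toENNReal
  empty := by
    have := capacity_le (A := ∅) (S := S) S.H.zero_mem (fun _ => le_rfl) (by simp)
    rw [S.E_zero] at this
    exact EReal.toENNReal_of_nonpos this
  mono h := EReal.toENNReal_le_toENNReal (S.capacity_mono h)
  iUnion_nat A _ := capacity_iUnion_le hm hc.1 A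

variable {hm : S.IsMonotoneClass} {hc : S.IsContinuous}

theorem capOuter_apply (A : Set Ω) : capOuter hm hc A = (S.capacity A).toENNReal := rfl

theorem capOuter_le_one (A : Set Ω) : capOuter hm hc A ≤ 1 := by
  have := EReal.toENNReal_le_toENNReal (S.capacity_le_one A)
  rwa [EReal.toENNReal_one] at this

theorem capOuter_eq_zero_iff {A : Set Ω} : capOuter hm hc A = 0 ↔ S.capacity A = 0 := by
  rw [capOuter_apply, EReal.toENNReal_eq_zero_iff]
  exact ⟨fun h => h.antisymm (S.capacity_nonneg A), fun h => h.le⟩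

theorem capOuter_le {A : Set Ω} (hX : S.L1 X) (h0 : ∀ ω, 0 ≤ X ω) (h : ∀ ω ∈ A, 1 ≤ X ω) :
    capOuter hm hc A ≤ ENNReal.ofReal (S.Ev X) := by
  have := EReal.toENNReal_le_toENNReal (capacity_le hX.1 h0 h)
  rw [← hX.coe_Ev] at this
  simpa [capOuter_apply] using this

theorem le_capOuter {A : Set Ω} (hX : S.L1 X) (h1 : ∀ ω, X ω ≤ 1) (h0 : ∀ ω ∉ A, X ω ≤ 0) :
    ENNReal.ofReal (S.Ev X) ≤ capOuter hm hc A := by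
  have := EReal.toENNReal_le_toENNReal (le_capacity hX.1 h1 h0)
  rw [← hX.coe_Ev] at this
  simpa [capOuter_apply] using this

/-- Markov's inequality. -/
theorem capOuter_markov (hX : S.L1 X) (h0 : ∀ ω, 0 ≤ X ω) {c : ℝ} (hc0 : 0 < c) :
    capOuter hm hc {ω | c ≤ X ω} ≤ ENNReal.ofReal (S.Ev X / c) := by
  rw [div_eq_inv_mul, ← Ev_const_mul hX (by positivity)]
  refine capOuter_le (hX.const_mul _) (fun ω => mul_nonneg (by positivity) (h0 ω)) fun ω hω => ?_
  rw [← div_eq_inv_mul, one_le_div hc0]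
  exact hω

theorem choquet_abs_lt_top_iff :
    S.choquet (fun ω => |X ω|) < ⊤ ↔
      ∫⁻ t in Ioi (0 : ℝ), capOuter hm hc {ω | t ≤ |X ω|} < ⊤ := by
  have h : ∫⁻ t in Iio (0 : ℝ), (1 - (S.capacity {ω | t ≤ |X ω|}).toENNReal) = 0 := by
    rw [setLIntegral_congr_fun (g := fun _ => 0) measurableSet_Iio fun t ht => ?_]
    · simp
    · have e : {ω | t ≤ |X ω|} = univ := by
        ext ω
        simpa using (le_of_lt ht).trans (abs_nonneg _)
      simp [e, S.capacity_univ, EReal.toENNReal_one]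
  rw [choquet, h]
  simp only [EReal.coe_ennreal_zero, sub_zero, capOuter_apply]
  rw [← EReal.coe_ennreal_top, EReal.coe_ennreal_lt_coe_ennreal_iff]

end SublinearExpectation

/-! ### Necessity of a finite Choquet integral: second Borel–Cantelli argument. -/

theorem iUnion_Ioc_nat_mul {a : ℝ} (ha : 0 < a) :
    ⋃ k : ℕ, Ioc (a * k) (a * (k + 1)) = Ioi (0 : ℝ) := by
  ext t
  simp only [mem_iUnion, mem_Ioc, mem_Ioi]
  constructor
  · rintro ⟨k, h, _⟩
    exact (by positivity : 0 ≤ a * k).trans_lt h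
  · intro ht
    have h0 : 0 < t / a := by positivity
    obtain ⟨k, hk⟩ : ∃ k, ⌈t / a⌉₊ = k + 1 := Nat.exists_eq_succ_of_ne_zero (Nat.ceil_pos.2 h0).ne'
    have h1 := Nat.le_ceil (t / a)
    have h2 := Nat.ceil_lt_add_one h0.le
    rw [hk] at h1 h2
    push_cast at h1 h2
    refine ⟨k, ?_, ?_⟩
    · rw [← lt_div_iff₀' ha]; linarith
    · rwa [← div_le_iff₀' ha]

theorem Antitone.lintegral_Ioi_le_tsum {p : ℝ → ENNReal} (hp : Antitone p) {a : ℝ} (ha : 0 < a) :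
    ∫⁻ t in Ioi (0 : ℝ), p t ≤ ∑' k : ℕ, p (a * k) * ENNReal.ofReal a := by
  rw [← iUnion_Ioc_nat_mul ha]
  refine (lintegral_iUnion_le _ _).trans (ENNReal.tsum_le_tsum fun k => ?_)
  calc _ ≤ ∫⁻ t in Ioc (a * k) (a * (k + 1)), p (a * k) :=
        setLIntegral_mono measurable_const fun t ht => hp ht.1.le
    _ = _ := by
        rw [setLIntegral_const, Real.volume_Ioc]
        congr 2
        ring

theorem Antitone.tsum_le_lintegral_Ioi {p : ℝ → ENNReal} (hp : Antitone p) :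
    ∑' k : ℕ, p (k + 1) ≤ ∫⁻ t in Ioi (0 : ℝ), p t := by
  rw [← iUnion_Ioc_nat_mul one_pos, lintegral_iUnion (fun _ => measurableSet_Ioc)]
  · refine ENNReal.tsum_le_tsum fun k => ?_
    calc p (k + 1) = ∫⁻ t in Ioc (1 * (k : ℝ)) (1 * (k + 1)), p (k + 1) := by simp
      _ ≤ _ := setLIntegral_mono' measurableSet_Ioc fun t ht => hp (by linarith [ht.2])
  · simp only [one_mul]
    have h := (Nat.mono_cast (α := ℝ)).pairwise_disjoint_on_Ioc_succ
    simpa using h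

theorem partialSum_succ {Ω : Type*} (X : ℕ → Ω → ℝ) (n : ℕ) (ω : Ω) :
    partialSum X (n + 1) ω = partialSum X n ω + X n ω := Finset.sum_range_succ _ _

theorem limsup_abs_partialSum_div_eq_top {Ω : Type*} {X : ℕ → Ω → ℝ} {ω : Ω}
    (h : ∀ m : ℕ, ∃ k ≥ m, ((m + 1 : ℝ) * (k + 1)) ≤ |X k ω|) :
    limsup (fun n : ℕ => ((|partialSum X n ω| / n : ℝ) : EReal)) atTop = ⊤ := by
  by_contra hne
  obtain ⟨R, hR, -⟩ := EReal.lt_iff_exists_real_btwn.1 (lt_top_iff_ne_top.2 hne)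
  obtain ⟨n₀, hn₀⟩ := eventually_atTop.1 (eventually_lt_of_limsup_lt hR)
  have hle : ∀ n ≥ n₀, |partialSum X n ω| ≤ |R| * n := fun n hn => by
    rcases Nat.eq_zero_or_pos n with rfl | hpos
    · simp [partialSum]
    · have h1 := EReal.coe_lt_coe_iff.1 (hn₀ n hn)
      rw [div_lt_iff₀ (by positivity)] at h1
      exact h1.le.trans (by gcongr; exact le_abs_self R)
  -- This index gives both `k ≥ n₀` and `|X k| ≥ (2|R| + 1)(k + 1)`, whereas the bounds on the sums
  -- up to `k` and `k + 1` give `|X k| ≤ |R| (2k + 1)`.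
  obtain ⟨k, hk, hX⟩ := h (n₀ + ⌈2 * |R|⌉₊)
  have h1 := hle k (by omega)
  have h2 := hle (k + 1) (by omega)
  rw [partialSum_succ] at h2
  have h3 : |X k ω| ≤ |partialSum X k ω + X k ω| + |partialSum X k ω| := by
    have := abs_sub (partialSum X k ω + X k ω) (partialSum X k ω)
    simpa using this
  have h4 := Nat.le_ceil (2 * |R|)
  have h5 : (2 * |R| + 1) * (k + 1) ≤ |X k ω| := by
    refine le_trans ?_ hX
    push_cast
    gcongr
    linarith [Nat.cast_nonneg (α := ℝ) n₀]
  push_cast at h2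
  nlinarith [abs_nonneg R, Nat.cast_nonneg (α := ℝ) k]

theorem tendsto_prod_one_sub_zero {p : ℕ → ℝ} (h0 : ∀ k, 0 ≤ p k) (h1 : ∀ k, p k ≤ 1)
    (h : ¬ Summable p) : Tendsto (fun N => ∏ k ∈ Finset.range N, (1 - p k)) atTop (𝓝 0) := by
  have hs := (not_summable_iff_tendsto_nat_atTop_of_nonneg h0).1 h
  refine squeeze_zero (fun N => Finset.prod_nonneg fun k _ => sub_nonneg.2 (h1 k)) (fun N => ?_)
    (Real.tendsto_exp_neg_atTop_nhds_zero.comp hs)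
  simp only [Function.comp, ← Finset.sum_neg_distrib, Real.exp_sum]
  exact Finset.prod_le_prod (fun k _ => sub_nonneg.2 (h1 k)) fun k _ => Real.one_sub_le_exp_neg _

theorem Fin.boundedLip_comp_eval {n : ℕ} {f : ℝ → ℝ} (hf : BoundedLip f) (i : Fin n) :
    BoundedLip (fun x : Fin n → ℝ => f (x i)) :=
  hf.comp (LipschitzWith.eval (α := fun _ : Fin n => ℝ) i)

namespace SublinearExpectation

variable {Ω : Type*} {S : SublinearExpectation Ω} {X : ℕ → Ω → ℝ}

/-- Only nonnegative constants leave a sublinear expectation. Given the past, the nonnegative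
product comes out of the expectation of `-f`; the remaining factor `-E[-f]` is nonnegative and comes
out in turn. -/
theorem IsIID.Ev_neg_prod (hX : S.IsIID X) {f : ℕ → ℝ → ℝ} (hf : ∀ k, BoundedLip (f k))
    (h0 : ∀ k x, 0 ≤ f k x) (n : ℕ) :
    S.Ev (fun ω => -∏ k ∈ Finset.range n, f k (X k ω)) =
      -∏ k ∈ Finset.range n, -S.Ev (fun ω => -f k (X 0 ω)) := by
  have hneg : ∀ k m, S.L1 (fun ω => -f k (X m ω)) := fun k m =>
    BoundedLip_L1_one (φ := fun x => -f k x) (hX.mem m) (hf k).neg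
  induction n with
  | zero => simp
  | succ n ih =>
    -- Independence concerns a nonempty past, so the one-factor product is treated apart.
    rcases n with _ | n
    · simp
    · have hg : BoundedLip (fun x : Fin (n + 1) → ℝ => ∏ k : Fin (n + 1), f k (x k)) :=
        BoundedLip.prod _ fun k _ => Fin.boundedLip_comp_eval (hf k) k
      have hφ : BoundedLip (fun z : (Fin (n + 1) → ℝ) × ℝ =>
          (∏ k : Fin (n + 1), f k (z.1 k)) * -f (n + 1) z.2) :=
        (hg.comp LipschitzWith.prod_fst).mul ((hf (n + 1)).neg.comp LipschitzWith.prod_snd)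
      have key := hX.Ev_prod_eq n hφ
      have hP0 : ∀ ω, 0 ≤ ∏ k : Fin (n + 1), f k (X k ω) := fun ω =>
        Finset.prod_nonneg fun k _ => h0 _ _
      have hinner : ∀ ω, S.Ev (fun ω' =>
          (∏ k : Fin (n + 1), f k (X k ω)) * -f (n + 1) (X (n + 1) ω')) =
          -S.Ev (fun ω => -f (n + 1) (X 0 ω)) * -∏ k : Fin (n + 1), f k (X k ω) := fun ω => by
        rw [Ev_const_mul (hneg _ _) (hP0 ω),
          hX.Ev_comp_eq (n + 1) (φ := fun x => -f (n + 1) x) (hf _).neg]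
        ring
      have hnn : 0 ≤ -S.Ev (fun ω => -f (n + 1) (X 0 ω)) := by
        rw [Right.nonneg_neg_iff]
        exact Ev_le_const (hneg _ _) fun ω => by simpa using h0 _ _
      have hL : S.L1 (fun ω => -∏ k : Fin (n + 1), f k (X k ω)) :=
        (BoundedLip_L1 (X := fun k : Fin (n + 1) => X k) (fun k => hX.mem k) hg).neg
      simp only [hinner] at key
      rw [Ev_const_mul hL hnn] at key
      simp only [Finset.prod_range_succ _ (n + 1)]
      simp only [Finset.prod_range] at ih ⊢
      rw [ih] at key
      simp only [mul_neg] at key ⊢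
      rw [key]
      ring

theorem IsIID.tendsto_Ev_one_sub_prod (hX : S.IsIID X) {f : ℕ → ℝ → ℝ}
    (hf : ∀ k, BoundedLip (f k)) (h0 : ∀ k x, 0 ≤ f k x) (h1 : ∀ k x, f k x ≤ 1)
    (h : ¬ Summable fun k => S.Ev (fun ω => f k (X 0 ω))) :
    Tendsto (fun N => S.Ev (fun ω => 1 - ∏ k ∈ Finset.range N, (1 - f k (X k ω)))) atTop
      (𝓝 1) := by
  have hL : ∀ k, S.L1 (fun ω => f k (X 0 ω)) := fun k => BoundedLip_L1_one (hX.mem 0) (hf k)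
  have hg : ∀ k, BoundedLip (fun x => 1 - f k x) := fun k => (BoundedLip.const 1).sub (hf k)
  have e : ∀ N, S.Ev (fun ω => 1 - ∏ k ∈ Finset.range N, (1 - f k (X k ω))) =
      1 - ∏ k ∈ Finset.range N, (1 - S.Ev (fun ω => f k (X 0 ω))) := fun N => by
    have hN : S.L1 (fun ω => -∏ k ∈ Finset.range N, (1 - f k (X k ω))) := by
      simp only [Finset.prod_range]
      exact (BoundedLip_L1 (X := fun k : Fin N => X k) (fun k => hX.mem k)
        (φ := fun x => ∏ k : Fin N, (1 - f k (x k)))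
        (BoundedLip.prod _ fun k _ => Fin.boundedLip_comp_eval (hg k) k)).neg
    have h2 := hX.Ev_neg_prod hg (fun k x => sub_nonneg.2 (h1 k x)) N
    have h3 : ∀ k, -S.Ev (fun ω => -(1 - f k (X 0 ω))) = 1 - S.Ev (fun ω => f k (X 0 ω)) :=
      fun k => by
        have e' : (fun ω => -(1 - f k (X 0 ω))) = fun ω => f k (X 0 ω) + -1 := by ext; ring
        rw [e', Ev_add_const (hL k)]
        ring
    simp only [h3] at h2
    have h4 := Ev_add_const hN 1
    rw [h2] at h4
    simp only [sub_eq_add_neg, add_comm (1 : ℝ)] at h4 ⊢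
    exact h4
  simp only [e]
  have := tendsto_prod_one_sub_zero (fun k => Ev_nonneg (hL k) fun ω => h0 _ _)
    (fun k => Ev_le_const (hL k) fun ω => h1 _ _) h
  simpa using this.const_sub 1

variable {hm : S.IsMonotoneClass} {hc : S.IsContinuous}

theorem antitone_capOuter_abs (Y : Ω → ℝ) : Antitone fun t : ℝ => capOuter hm hc {ω | t ≤ |Y ω|} :=
  fun _ _ hst => measure_mono fun _ hω => hst.trans hω

theorem choquet_lt_top_of_summable {Y : Ω → ℝ} {a : ℝ} (ha : 0 < a) {p : ℕ → ℝ}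
    (hp : Summable p) {n₀ : ℕ}
    (h : ∀ k ≥ n₀, capOuter hm hc {ω | a * (k + 1) ≤ |Y ω|} ≤ ENNReal.ofReal (p k)) :
    S.choquet (fun ω => |Y ω|) < ⊤ := by
  rw [choquet_abs_lt_top_iff (hm := hm) (hc := hc)]
  refine ((antitone_capOuter_abs Y).lintegral_Ioi_le_tsum ha).trans_lt ?_
  rw [ENNReal.tsum_mul_right]
  refine ENNReal.mul_lt_top ?_ ENNReal.ofReal_lt_top
  -- The terms `0, …, n₀` are bounded only by `1`; term `k + 1` is the one controlled by `p k`.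
  rw [← Summable.sum_add_tsum_nat_add' (k := n₀ + 1) ENNReal.summable]
  refine ENNReal.add_lt_top.2 ⟨ENNReal.sum_lt_top.2 fun k _ =>
    (capOuter_le_one _).trans_lt ENNReal.one_lt_top, ?_⟩
  have hs := ((summable_nat_add_iff n₀).2 hp).tsum_ofReal_lt_top
  refine lt_of_le_of_lt (ENNReal.tsum_le_tsum fun k => ?_) hs
  have := h (k + n₀) (by omega)
  push_cast at this ⊢
  simpa only [add_assoc] using this

/-- If `𝕍(lim sup |Sₙ| / n = ∞) < 1` then the Choquet integral of `|X₁|` is finite. -/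
theorem IsIID.choquet_lt_top (hm : S.IsMonotoneClass) (hc : S.IsContinuous) (hX : S.IsIID X)
    (h : S.capacity {ω | limsup (fun n : ℕ => ((|partialSum X n ω| / n : ℝ) : EReal)) atTop = ⊤}
      < 1) : S.choquet (fun ω => |X 0 ω|) < ⊤ := by
  by_contra hch
  obtain ⟨ξ, hξ, hξ0, hξ1, hEξ⟩ := exists_lt_of_capacity_lt h
  -- `f m k` is positive only when `k ≥ m` and `|x| > (m+1)(k+1)`, and equals `1` once `k ≥ m` and
  -- `|x| ≥ 2(m+1)(k+1)`. The first fact yields large late jumps; the second compares sums of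
  -- expectations with the Choquet integral.
  set f : ℕ → ℕ → ℝ → ℝ := fun m k x =>
    if k < m then 0 else clamp 0 1 (|x| / ((m + 1) * (k + 1)) - 1) with hfdef
  have hf0 : ∀ m k x, 0 ≤ f m k x := fun m k x => by
    simp only [hfdef]; split_ifs
    exacts [le_rfl, (clamp_mem zero_le_one _).1]
  have hf1 : ∀ m k x, f m k x ≤ 1 := fun m k x => by
    simp only [hfdef]; split_ifs
    exacts [zero_le_one, (clamp_mem zero_le_one _).2]
  have hfBL : ∀ m k, BoundedLip (f m k) := fun m k => by
    by_cases hkm : k < m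
    · simpa only [hfdef, if_pos hkm] using BoundedLip.const 0
    · simp only [hfdef, if_neg hkm]
      have hpos : (0 : ℝ) < (m + 1) * (k + 1) := by positivity
      refine (boundedLip_clamp zero_le_one).comp
        (K := (((m + 1) * (k + 1))⁻¹ : ℝ).toNNReal) (LipschitzWith.of_dist_le_mul fun x y => ?_)
      rw [Real.coe_toNNReal _ (by positivity), Real.dist_eq, Real.dist_eq, sub_sub_sub_cancel_right,
        ← sub_div, abs_div, abs_of_pos hpos, div_eq_inv_mul]
      exact mul_le_mul_of_nonneg_left (abs_abs_sub_abs_le x y) (by positivity)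
  have hfanti : ∀ k x, Antitone fun m => f m k x := fun k x m m' hmm => by
    by_cases hk : k < m'
    · simpa only [hfdef, if_pos hk] using hf0 m k x
    · simp only [hfdef, if_neg hk, if_neg (show ¬ k < m by omega)]
      unfold clamp
      gcongr
  have hfpos : ∀ m k x, 0 < f m k x → m ≤ k ∧ ((m + 1 : ℝ) * (k + 1)) ≤ |x| := fun m k x hp => by
    by_cases hk : k < m
    · simp [hfdef, if_pos hk] at hp
    · simp only [hfdef, if_neg hk, clamp, lt_max_iff, lt_irrefl, lt_min_iff, false_or] at hp
      have h1 := hp.1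
      rw [sub_pos, one_lt_div (by positivity)] at h1
      exact ⟨by omega, h1.le⟩
  have hns : ∀ m, ¬ Summable fun k => S.Ev (fun ω => f m k (X 0 ω)) := fun m hs => by
    refine hch (choquet_lt_top_of_summable (hm := hm) (hc := hc) (a := 2 * (m + 1))
      (by positivity) hs (n₀ := m) fun k hk => ?_)
    refine capOuter_le (BoundedLip_L1_one (hX.mem 0) (hfBL m k)) (fun ω => hf0 _ _ _)
      fun ω hω => ?_
    have hω' : 2 * (m + 1) * (k + 1) ≤ |X 0 ω| := hω
    simp only [hfdef, if_neg (not_lt.2 hk), clamp]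
    refine le_max_of_le_right (le_min ?_ le_rfl)
    rw [le_sub_iff_add_le, le_div_iff₀ (by positivity)]
    linarith
  set F : ℕ → ℕ → Ω → ℝ := fun m N ω => 1 - ∏ k ∈ Finset.range N, (1 - f m k (X k ω)) with hF
  have hprod0 : ∀ m N ω, 0 ≤ ∏ k ∈ Finset.range N, (1 - f m k (X k ω)) := fun m N ω =>
    Finset.prod_nonneg fun k _ => sub_nonneg.2 (hf1 _ _ _)
  have hF1 : ∀ m N ω, F m N ω ≤ 1 := fun m N ω => sub_le_self _ (hprod0 m N ω)
  have hF0 : ∀ m N ω, 0 ≤ F m N ω := fun m N ω =>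
    sub_nonneg.2 (Finset.prod_le_one (fun k _ => sub_nonneg.2 (hf1 _ _ _))
      fun k _ => sub_le_self _ (hf0 _ _ _))
  have hFL : ∀ m N, S.L1 (F m N) := fun m N => by
    simp only [hF, Finset.prod_range]
    exact BoundedLip_L1 (X := fun k : Fin N => X k) (fun k => hX.mem k)
      (φ := fun x => 1 - ∏ k : Fin N, (1 - f m k (x k)))
      ((BoundedLip.const 1).sub (BoundedLip.prod _ fun k _ => Fin.boundedLip_comp_eval
        ((BoundedLip.const 1).sub (hfBL m k)) k))
  have hFmono : ∀ m, Monotone (F m) := fun m => monotone_nat_of_le_succ fun N ω => by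
    simp only [hF, Finset.prod_range_succ]
    exact sub_le_sub_left (mul_le_of_le_one_right (hprod0 m N ω) (sub_le_self _ (hf0 _ _ _))) _
  have hbdd : ∀ m ω, BddAbove (range fun N => F m N ω) := fun m ω =>
    ⟨1, by rintro _ ⟨N, rfl⟩; exact hF1 m N ω⟩
  -- `g m` is a smooth substitute for the indicator that some `f m k (X k)` is positive; it
  -- decreases in `m` and has expectation `1`.
  set g : ℕ → Ω → ℝ := fun m ω => ⨆ N, F m N ω with hg
  have hlim : ∀ m ω, Tendsto (fun N => F m N ω) atTop (𝓝 (g m ω)) := fun m ω =>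
    tendsto_atTop_ciSup (fun N N' h => hFmono m h ω) (hbdd m ω)
  have hgmem : ∀ m, g m ∈ S.H := fun m =>
    hm.mem_of_monotone (fun N => (hFL m N).1) (hFmono m) (hF1 m) (hlim m)
  have hg0 : ∀ m ω, 0 ≤ g m ω := fun m ω => Real.iSup_nonneg fun N => hF0 m N ω
  have hg1 : ∀ m ω, g m ω ≤ 1 := fun m ω => ciSup_le fun N => hF1 m N ω
  have hEg : ∀ m, S.E (g m) = 1 := fun m => by
    refine tendsto_nhds_unique (hc.1 _ _ (fun N => (hFL m N).1) (hgmem m) (hF0 m) (hFmono m)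
      (hlim m)) ?_
    simp only [← (hFL m _).coe_Ev]
    rw [← EReal.coe_one, EReal.tendsto_coe]
    exact hX.tendsto_Ev_one_sub_prod (hfBL m) (hf0 m) (hf1 m) (hns m)
  have hganti : Antitone g := fun m m' hmm ω =>
    ciSup_mono (hbdd m ω) fun N => sub_le_sub_left (Finset.prod_le_prod
      (fun k _ => sub_nonneg.2 (hf1 _ _ _)) fun k _ => sub_le_sub_left (hfanti k _ hmm) _) _
  have hgbdd : ∀ ω, BddBelow (range fun m => g m ω) := fun ω =>
    ⟨0, by rintro _ ⟨m, rfl⟩; exact hg0 m ω⟩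
  have hglim : ∀ ω, Tendsto (fun m => g m ω) atTop (𝓝 (⨅ m, g m ω)) := fun ω =>
    tendsto_atTop_ciInf (fun m m' h => hganti h ω) (hgbdd ω)
  have hmem : (fun ω => ⨅ m, g m ω) ∈ S.H :=
    hm g _ hgmem hganti hglim fun ω => Real.iInf_nonneg fun m => hg0 m ω
  have hE : S.E (fun ω => ⨅ m, g m ω) = 1 := by
    refine tendsto_nhds_unique (hc.2 g _ hgmem hmem hg0 hganti hglim ?_) ?_
    · rw [hEg, ← EReal.coe_one]; exact EReal.coe_lt_top _
    · simp only [hEg]; exact tendsto_const_nhds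
  -- The infimum of the `g m` is at most `1` and vanishes off the event, so `ξ` dominates it and `E
  -- ξ ≥ 1`.
  refine hEξ.not_ge (hE ▸ S.mono _ hξ _ hmem fun ω => ?_)
  by_cases hω : limsup (fun n : ℕ => ((|partialSum X n ω| / n : ℝ) : EReal)) atTop = ⊤
  · exact ((ciInf_le (hgbdd ω) 0).trans (hg1 0 ω)).trans (hξ1 ω hω)
  · refine le_trans ?_ (hξ0 ω)
    by_contra! hpos
    refine hω (limsup_abs_partialSum_div_eq_top fun m => ?_)
    obtain ⟨N, hN⟩ := exists_lt_of_lt_ciSup (hpos.trans_le (ciInf_le (hgbdd ω) m))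
    by_contra! hno
    have hz : ∀ k, f m k (X k ω) = 0 := fun k => by
      by_contra hk
      obtain ⟨h1, h2⟩ := hfpos m k _ ((hf0 m k _).lt_of_ne' hk)
      exact absurd h2 (hno k h1).not_ge
    simp [hF, hz] at hN

end SublinearExpectation

/-! ### Deterministic estimates: layer sums, series, subsequences. -/

theorem boundedLip_clamp_abs_sub (a : ℝ) : BoundedLip (fun x : ℝ => clamp 0 1 (|x| - a)) :=
  (boundedLip_clamp zero_le_one).comp (lipschitzWith_one_norm.sub (LipschitzWith.const a))

theorem min_eq_sum_clamp {y : ℝ} (hy : 0 ≤ y) (k : ℕ) :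
    min y k = ∑ i ∈ Finset.range k, clamp 0 1 (y - i) := by
  induction k with
  | zero => simpa using hy
  | succ k ih =>
    rw [Finset.sum_range_succ, ← ih]
    push_cast
    simp only [clamp, min_def, max_def]
    split_ifs <;> linarith

/-- On the layer `[i, i+1]` the square grows by `2i + 1`, and by convexity it lies below its chord.
-/
theorem min_sq_le_sum_clamp {y : ℝ} (hy : 0 ≤ y) (k : ℕ) :
    (min y k) ^ 2 ≤ ∑ i ∈ Finset.range k, (2 * i + 1) * clamp 0 1 (y - i) := by
  induction k with
  | zero => simp [min_eq_right hy]
  | succ k ih =>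
    rw [Finset.sum_range_succ]
    refine le_trans ?_ (add_le_add_left ih _)
    have hk : (0 : ℝ) ≤ k := k.cast_nonneg
    push_cast
    rcases le_total y k with h | h
    · rw [min_eq_left h, min_eq_left (by linarith)]
      have := (clamp_mem zero_le_one (y - k)).1
      nlinarith
    · rw [min_eq_right h]
      rcases le_total y (k + 1) with h' | h'
      · rw [min_eq_left h', clamp, min_eq_left (by linarith), max_eq_right (by linarith)]
        nlinarith
      · rw [min_eq_right h', clamp, min_eq_right (by linarith), max_eq_right zero_le_one]
        nlinarith

/-- A summation by parts replacing an exchange of sums: the subtracted term makes the induction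
close, through `1/(N+1)² + 1/(N+1) ≤ 1/N`. -/
theorem sum_weighted_div_sq_le {q : ℕ → ℝ} (hq : ∀ i, 0 ≤ q i) (N : ℕ) :
    ∑ k ∈ Finset.range N, (∑ i ∈ Finset.range (k + 1), (2 * i + 1) * q i) / (k + 1 : ℝ) ^ 2 ≤
      4 * ∑ i ∈ Finset.range N, q i - (∑ i ∈ Finset.range N, (2 * i + 1) * q i) / N := by
  induction N with
  | zero => simp
  | succ N ih =>
    rw [Finset.sum_range_succ, Finset.sum_range_succ q]
    refine (add_le_add_left ih _).trans ?_
    rw [Finset.sum_range_succ _ N]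
    set Q := ∑ i ∈ Finset.range N, (2 * (i : ℝ) + 1) * q i with hQ
    have hQ0 : 0 ≤ Q := Finset.sum_nonneg fun i _ => mul_nonneg (by positivity) (hq i)
    have hqN := hq N
    push_cast
    have h2 : (2 * (N : ℝ) + 1) * q N / (N + 1) ^ 2 + (2 * N + 1) * q N / (N + 1) ≤ 4 * q N := by
      rw [div_add_div _ _ (by positivity) (by positivity), div_le_iff₀ (by positivity)]
      have hN : (0 : ℝ) ≤ N := N.cast_nonneg
      have : (2 * (N : ℝ) + 1) * (N + 1) + (N + 1) ^ 2 * (2 * N + 1) ≤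
          4 * ((N + 1) ^ 2 * (N + 1)) := by nlinarith [mul_nonneg hN hN, mul_nonneg (mul_nonneg hN hN) hN]
      nlinarith
    have h3 : Q / (N + 1 : ℝ) ^ 2 + Q / (N + 1) ≤ Q / N := by
      rcases Nat.eq_zero_or_pos N with rfl | hN
      · simp [hQ]
      · have hN' : (0 : ℝ) < N := by exact_mod_cast hN
        rw [div_add_div _ _ (by positivity) (by positivity), div_le_div_iff₀ (by positivity) hN']
        have : ((N : ℝ) + 1 + (N + 1) ^ 2) * N ≤ (N + 1) ^ 2 * (N + 1) := by nlinarith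
        nlinarith
    simp only [add_div]
    linarith

theorem summable_weighted_div_sq {q : ℕ → ℝ} (hq : ∀ i, 0 ≤ q i) (hs : Summable q) :
    Summable fun k : ℕ =>
      (∑ i ∈ Finset.range (k + 1), (2 * i + 1) * q i) / (k + 1 : ℝ) ^ 2 := by
  have hQ : ∀ k, 0 ≤ ∑ i ∈ Finset.range k, (2 * (i : ℝ) + 1) * q i := fun k =>
    Finset.sum_nonneg fun i _ => mul_nonneg (by positivity) (hq i)
  refine summable_of_sum_range_le (c := 4 * ∑' i, q i)
    (fun k => div_nonneg (hQ _) (by positivity)) fun N => (sum_weighted_div_sq_le hq N).trans ?_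
  have h1 := hs.sum_le_tsum (Finset.range N) fun i _ => hq i
  have h2 := div_nonneg (hQ N) N.cast_nonneg
  linarith

theorem one_le_floor_pow {c : ℝ} (hc : 1 < c) (j : ℕ) : 1 ≤ ⌊c ^ j⌋₊ :=
  Nat.le_floor (by simpa using one_le_pow₀ hc.le)

theorem summable_sum_div_floor_pow_sq {v : ℕ → ℝ} (hv : ∀ k, 0 ≤ v k)
    (hs : Summable fun k : ℕ => v k / (k + 1 : ℝ) ^ 2) {c : ℝ} (hc : 1 < c) :
    Summable fun j : ℕ => (∑ k ∈ Finset.range ⌊c ^ j⌋₊, v k) / (⌊c ^ j⌋₊ : ℝ) ^ 2 := by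
  set C := c ^ 5 * (c - 1)⁻¹ ^ 3 with hC
  have hC0 : 0 ≤ C := by
    have := sub_pos.2 hc
    positivity
  refine summable_of_sum_range_le (c := 4 * C * ∑' k : ℕ, v k / (k + 1 : ℝ) ^ 2)
    (fun j => div_nonneg (Finset.sum_nonneg fun k _ => hv k) (by positivity)) fun N => ?_
  -- The threshold `k + 1/2` encodes `k < ⌊c ^ j⌋₊` and stays positive at `k = 0`, as
  -- `sum_div_nat_floor_pow_sq_le_div_sq` needs. The factor `4` comes from `(k+1)² ≤ 4 (k+1/2)²`.
  have h1 : ∀ j ∈ Finset.range N, (∑ k ∈ Finset.range ⌊c ^ j⌋₊, v k) / (⌊c ^ j⌋₊ : ℝ) ^ 2 =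
      ∑ k ∈ Finset.range ⌊c ^ N⌋₊,
        if (k + 1 / 2 : ℝ) < ⌊c ^ j⌋₊ then v k * (1 / (⌊c ^ j⌋₊ : ℝ) ^ 2) else 0 := fun j hj => by
    rw [Finset.sum_div, ← Finset.sum_filter]
    simp only [mul_one_div]
    refine Finset.sum_congr ?_ fun _ _ => rfl
    ext k
    have hle : ⌊c ^ j⌋₊ ≤ ⌊c ^ N⌋₊ :=
      Nat.floor_le_floor (pow_le_pow_right₀ hc.le (Finset.mem_range.1 hj).le)
    simp only [Finset.mem_range, Finset.mem_filter]
    constructor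
    · intro h
      have : (k + 1 : ℝ) ≤ ⌊c ^ j⌋₊ := by exact_mod_cast h
      exact ⟨by omega, by linarith⟩
    · rintro ⟨-, h⟩
      have : (k : ℝ) < ⌊c ^ j⌋₊ := by linarith
      exact_mod_cast this
  rw [Finset.sum_congr rfl h1, Finset.sum_comm]
  have h2 : ∀ k : ℕ, (∑ j ∈ Finset.range N,
      if (k + 1 / 2 : ℝ) < ⌊c ^ j⌋₊ then v k * (1 / (⌊c ^ j⌋₊ : ℝ) ^ 2) else 0) ≤
      4 * C * (v k / (k + 1 : ℝ) ^ 2) := fun k => by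
    rw [← Finset.sum_filter, ← Finset.mul_sum]
    have h3 := sum_div_nat_floor_pow_sq_le_div_sq N (j := (k + 1 / 2 : ℝ)) (by positivity) hc
    refine (mul_le_mul_of_nonneg_left h3 (hv k)).trans ?_
    rw [← hC, ← mul_div_assoc, ← mul_div_assoc, div_le_div_iff₀ (by positivity) (by positivity)]
    have hk : (0 : ℝ) ≤ k := k.cast_nonneg
    have h4 : (k + 1 : ℝ) ^ 2 ≤ 4 * (k + 1 / 2) ^ 2 := by nlinarith
    have h5 := mul_le_mul_of_nonneg_left h4 (mul_nonneg (hv k) hC0)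
    linarith
  refine (Finset.sum_le_sum fun k _ => h2 k).trans ?_
  rw [← Finset.mul_sum]
  exact mul_le_mul_of_nonneg_left (hs.sum_le_tsum _ fun k _ => div_nonneg (hv k) (by positivity))
    (by positivity)

/-- Since `u` drops by at most `b` per step, adding `b * n` to its positive part gives a monotone
sequence, for which geometric subsequences determine the limit `b`. -/
theorem tendsto_max_div_of_floor_pow {u : ℕ → ℝ} {b : ℝ} (hb : 0 ≤ b)
    (hu : ∀ n, u n - b ≤ u (n + 1)) {c : ℕ → ℝ} (hc1 : ∀ r, 1 < c r)
    (hclim : Tendsto c atTop (𝓝 1))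
    (h : ∀ r, Tendsto (fun j : ℕ => max (u ⌊c r ^ j⌋₊) 0 / (⌊c r ^ j⌋₊ : ℝ)) atTop (𝓝 0)) :
    Tendsto (fun n : ℕ => max (u n) 0 / (n : ℝ)) atTop (𝓝 0) := by
  have hmono : Monotone fun n : ℕ => max (u n) 0 + b * n := monotone_nat_of_le_succ fun n => by
    push_cast
    have := hu n
    rcases le_total (u n) 0 with h0 | h0
    · rw [max_eq_right h0]; nlinarith [le_max_right (u (n + 1)) 0]
    · rw [max_eq_left h0]; nlinarith [le_max_left (u (n + 1)) 0]
  have key := tendsto_div_of_monotone_of_tendsto_div_floor_pow _ b hmono c hc1 hclim fun r => by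
    have := (h r).add_const b
    rw [zero_add] at this
    refine this.congr fun j => ?_
    have hpos : (0 : ℝ) < ⌊c r ^ j⌋₊ := by exact_mod_cast one_le_floor_pow (hc1 r) j
    field_simp
  have := key.sub_const b
  rw [sub_self] at this
  refine this.congr' ?_
  filter_upwards [eventually_gt_atTop 0] with n hn
  have hpos : (0 : ℝ) < n := by exact_mod_cast hn
  field_simp
  ring

/-! ### The strong law under a finite Choquet integral. -/

namespace SublinearExpectation

variable {Ω : Type*} {S : SublinearExpectation Ω} {X : ℕ → Ω → ℝ} {Y : Ω → ℝ}

theorem summable_Ev_clamp (hm : S.IsMonotoneClass) (hc : S.IsContinuous) (hY : Y ∈ S.H)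
    (h : S.choquet (fun ω => |Y ω|) < ⊤) :
    Summable fun i : ℕ => S.Ev fun ω => clamp 0 1 (|Y ω| - i) := by
  rw [choquet_abs_lt_top_iff (hm := hm) (hc := hc)] at h
  have hL : ∀ a : ℝ, S.L1 fun ω => clamp 0 1 (|Y ω| - a) := fun a =>
    BoundedLip_L1_one hY (boundedLip_clamp_abs_sub a)
  rw [← summable_nat_add_iff 1]
  have h1 : ∑' i : ℕ, ENNReal.ofReal (S.Ev fun ω => clamp 0 1 (|Y ω| - (i + 1 : ℕ))) ≠ ⊤ := by
    refine (((ENNReal.tsum_le_tsum fun i => ?_).trans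
      (antitone_capOuter_abs Y).tsum_le_lintegral_Ioi).trans_lt h).ne
    refine le_capOuter (hL _) (fun ω => (clamp_mem zero_le_one _).2) fun ω hω => ?_
    have hω' : |Y ω| < i + 1 := not_le.1 hω
    refine max_le le_rfl ((min_le_left _ _).trans ?_)
    push_cast
    linarith
  refine (ENNReal.summable_toReal h1).congr fun i => ?_
  exact ENNReal.toReal_ofReal (Ev_nonneg (hL _) fun ω => (clamp_mem zero_le_one _).1)

/-- The layers add up to `min |Y| k`, whose expectations stay below the sum of the series;
continuity from below passes to `|Y|`. -/
theorem L1_of_summable (hc : S.IsContinuous) (hY : Y ∈ S.H)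
    (h : Summable fun i : ℕ => S.Ev fun ω => clamp 0 1 (|Y ω| - i)) : S.L1 Y := by
  have hL : ∀ a : ℝ, S.L1 fun ω => clamp 0 1 (|Y ω| - a) := fun a =>
    BoundedLip_L1_one hY (boundedLip_clamp_abs_sub a)
  have hmin : ∀ k : ℕ, S.L1 fun ω => min |Y ω| k := fun k =>
    L1.of_bdd (C := k) (S.comp_mem_one (S.abs_mem hY) (LipschitzWith.id.min_const k)) fun ω => by
      rw [abs_of_nonneg (le_min (abs_nonneg _) k.cast_nonneg)]
      exact min_le_right _ _
  refine ⟨hY, lt_of_le_of_lt ?_ (EReal.coe_lt_top (∑' i : ℕ, S.Ev fun ω => clamp 0 1 (|Y ω| - i)))⟩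
  refine le_of_tendsto' (hc.1 (fun k ω => min |Y ω| (k : ℝ)) _ (fun k => (hmin k).1) (S.abs_mem hY)
    (fun k ω => le_min (abs_nonneg _) k.cast_nonneg)
    (fun k l hkl ω => min_le_min_left _ (Nat.cast_le.2 hkl)) fun ω => ?_) fun k => ?_
  · refine tendsto_const_nhds.congr' ?_
    filter_upwards [eventually_ge_atTop ⌈|Y ω|⌉₊] with k hk
    exact (min_eq_left (Nat.ceil_le.1 hk)).symm
  · rw [← (hmin k).coe_Ev, EReal.coe_le_coe_iff]
    simp only [min_eq_sum_clamp (abs_nonneg _)]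
    refine (Ev_sum_le (Finset.range k) fun (i : ℕ) _ => hL i).trans ?_
    exact h.sum_le_tsum (Finset.range k) (fun i _ => Ev_nonneg (hL i) fun ω => (clamp_mem zero_le_one _).1)

theorem L1.max_abs_sub (hY : S.L1 Y) (c : ℝ) : S.L1 fun ω => max (|Y ω| - c) 0 :=
  hY.abs.comp (φ := fun x => max (x - c) 0)
    ((by simpa using LipschitzWith.id.sub (LipschitzWith.const c) :
      LipschitzWith 1 fun x : ℝ => x - c).max_const 0)

theorem tendsto_Ev_max_abs_sub (hc : S.IsContinuous) (hY : S.L1 Y) :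
    Tendsto (fun c : ℕ => S.Ev fun ω => max (|Y ω| - c) 0) atTop (𝓝 0) := by
  have h := hc.2 (fun (c : ℕ) ω => max (|Y ω| - c) 0) 0 (fun c => (hY.max_abs_sub c).1)
    S.H.zero_mem (fun c ω => le_max_right _ _)
    (fun k l hkl ω => max_le_max_right _ (sub_le_sub_left (Nat.cast_le.2 hkl) _)) (fun ω => ?_) ?_
  · rw [S.E_zero, ← EReal.coe_zero] at h
    simpa only [← (hY.max_abs_sub _).coe_Ev, EReal.tendsto_coe] using h
  · refine tendsto_const_nhds.congr' ?_
    filter_upwards [eventually_ge_atTop ⌈|Y ω|⌉₊] with k hk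
    exact (max_eq_right (sub_nonpos.2 (Nat.ceil_le.1 hk))).symm
  · rw [← (hY.max_abs_sub _).coe_Ev]
    exact EReal.coe_lt_top _

theorem L1_sum_comp (hX : ∀ k, X k ∈ S.H) {w : ℕ → ℝ → ℝ} (hw : ∀ k, BoundedLip (w k)) (n : ℕ) :
    S.L1 fun ω => (max (∑ k ∈ Finset.range n, w k (X k ω)) 0) ^ 2 := by
  simp only [Finset.sum_range]
  exact BoundedLip_L1 (X := fun k : Fin n => X k) (fun k => hX k)
    (φ := fun x => (max (∑ k : Fin n, w k (x k)) 0) ^ 2)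
    (BoundedLip.sum Finset.univ fun (k : Fin n) _ => Fin.boundedLip_comp_eval (hw k) k).max_zero.sq

theorem max_add_sq_le (a y : ℝ) : (max (a + y) 0) ^ 2 ≤ 2 * max a 0 * y + (y ^ 2 + (max a 0) ^ 2) := by
  have h0 := le_max_right a 0
  have h1 : max (a + y) 0 ≤ |max a 0 + y| :=
    max_le ((add_le_add_left (le_max_left a 0) y).trans (le_abs_self _)) (abs_nonneg _)
  have h2 := pow_le_pow_left₀ (le_max_right (a + y) 0) h1 2
  rw [sq_abs] at h2
  linarith

/-- One-sided second moment bound for sums of independent variables with nonpositive upper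
expectations. -/
theorem IsIID.Ev_max_sum_sq_le (hX : S.IsIID X) {w : ℕ → ℝ → ℝ} (hw : ∀ k, BoundedLip (w k))
    (h0 : ∀ k, S.Ev (fun ω => w k (X 0 ω)) ≤ 0) (n : ℕ) :
    S.Ev (fun ω => (max (∑ k ∈ Finset.range n, w k (X k ω)) 0) ^ 2) ≤
      ∑ k ∈ Finset.range n, S.Ev (fun ω => (w k (X 0 ω)) ^ 2) := by
  have hLw : ∀ k m, S.L1 (fun ω => w k (X m ω)) := fun k m => BoundedLip_L1_one (hX.mem m) (hw k)
  have hLw2 : ∀ k m, S.L1 (fun ω => (w k (X m ω)) ^ 2) := fun k m =>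
    BoundedLip_L1_one (hX.mem m) (hw k).sq
  -- Here `a` is the frozen value of the preceding sum. The cross term is `2 a⁺ E[w] ≤ 0`, which is
  -- why the positive part is squared and not the sum itself.
  have hstep : ∀ k m (a : ℝ), S.Ev (fun ω => (max (a + w k (X m ω)) 0) ^ 2) ≤
      (max a 0) ^ 2 + S.Ev (fun ω => (w k (X 0 ω)) ^ 2) := fun k m a => by
    have hL1 := (hLw k m).const_mul (2 * max a 0)
    have hL2 := (hLw2 k m).add (L1.const ((max a 0) ^ 2))
    refine (Ev_mono (BoundedLip_L1_one (hX.mem m)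
      ((BoundedLip.const a).add (hw k)).max_zero.sq) (hL1.add hL2) fun ω =>
        max_add_sq_le a _).trans ((Ev_add_le hL1 hL2).trans ?_)
    have hnn : 0 ≤ 2 * max a 0 := by positivity
    rw [Ev_const_mul (hLw k m) hnn, Ev_add_const (hLw2 k m), hX.Ev_comp_eq m (hw k),
      hX.Ev_comp_eq m (hw k).sq]
    linarith [mul_nonpos_of_nonneg_of_nonpos hnn (h0 k)]
  induction n with
  | zero => simp
  | succ n ih =>
    rcases n with _ | n
    · simpa using hstep 0 0 0
    · have hg : BoundedLip (fun x : Fin (n + 1) → ℝ => ∑ k : Fin (n + 1), w k (x k)) :=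
        BoundedLip.sum _ fun k _ => Fin.boundedLip_comp_eval (hw k) k
      have hφ : BoundedLip (fun z : (Fin (n + 1) → ℝ) × ℝ =>
          (max ((∑ k : Fin (n + 1), w k (z.1 k)) + w (n + 1) z.2) 0) ^ 2) :=
        ((hg.comp LipschitzWith.prod_fst).add
          ((hw (n + 1)).comp LipschitzWith.prod_snd)).max_zero.sq
      have key := hX.Ev_prod_eq n hφ
      have hL1 := BoundedLip_L1 (X := fun k : Fin (n + 1) => X k) (fun k => hX.mem k)
        (boundedLip_Ev (hX.mem (n + 1)) hφ)
      have hL2 := L1_sum_comp hX.mem hw (n + 1)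
      simp only [Finset.sum_range_succ _ (n + 1)]
      simp only [Finset.sum_range] at ih hL2 ⊢
      rw [key]
      have hle := Ev_mono hL1
        (hL2.add (L1.const (S.Ev (fun ω => (w (n + 1) (X 0 ω)) ^ 2)))) fun ω =>
          hstep (n + 1) (n + 1) (∑ k : Fin (n + 1), w k (X k ω))
      rw [Ev_add_const hL2] at hle
      exact hle.trans (add_le_add_left ih _)

variable {hm : S.IsMonotoneClass} {hc : S.IsContinuous}

/-- Chebyshev and Borel–Cantelli apply along `⌊c r ^ j⌋₊` for countably many ratios `c r → 1` and
tolerances `1/(l+1)`; the lower bound `-b` controls the sums in between. -/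
theorem IsIID.ae_tendsto_max_sum_div (hX : S.IsIID X) {w : ℕ → ℝ → ℝ}
    (hw : ∀ k, BoundedLip (w k)) (h0 : ∀ k, S.Ev (fun ω => w k (X 0 ω)) ≤ 0)
    {b : ℝ} (hb : 0 ≤ b) (hwb : ∀ k x, -b ≤ w k x)
    (hs : Summable fun k : ℕ => S.Ev (fun ω => (w k (X 0 ω)) ^ 2) / (k + 1 : ℝ) ^ 2) :
    ∀ᵐ ω ∂(capOuter hm hc),
      Tendsto (fun n : ℕ => max (∑ k ∈ Finset.range n, w k (X k ω)) 0 / (n : ℝ)) atTop (𝓝 0) := by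
  set c : ℕ → ℝ := fun r => 1 + 1 / ((r : ℝ) + 1) with hcdef
  have hc1 : ∀ r, 1 < c r := fun r => by
    have : (0 : ℝ) < 1 / ((r : ℝ) + 1) := by positivity
    simp only [hcdef]; linarith
  have hclim : Tendsto c atTop (𝓝 1) := by
    simpa [hcdef] using tendsto_one_div_add_atTop_nhds_zero_nat.const_add (1 : ℝ)
  have hae : ∀ᵐ ω ∂(capOuter hm hc), ∀ r l : ℕ, ∀ᶠ j : ℕ in atTop,
      ω ∉ {ω | (1 / ((l : ℝ) + 1) * ⌊c r ^ j⌋₊) ^ 2 ≤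
        (max (∑ k ∈ Finset.range ⌊c r ^ j⌋₊, w k (X k ω)) 0) ^ 2} := by
    refine ae_all_iff.2 fun r => ae_all_iff.2 fun l => ae_eventually_notMem ?_
    have hv : ∀ k, 0 ≤ S.Ev (fun ω => (w k (X 0 ω)) ^ 2) := fun k =>
      Ev_nonneg (BoundedLip_L1_one (hX.mem 0) (hw k).sq) fun ω => sq_nonneg _
    have hsum := (summable_sum_div_floor_pow_sq hv hs (hc1 r)).mul_left (((l : ℝ) + 1) ^ 2)
    refine ((ENNReal.tsum_le_tsum fun j => ?_).trans_lt hsum.tsum_ofReal_lt_top).ne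
    have hpos : (0 : ℝ) < ⌊c r ^ j⌋₊ := by exact_mod_cast one_le_floor_pow (hc1 r) j
    refine (capOuter_markov (L1_sum_comp hX.mem hw _) (fun ω => sq_nonneg _)
      (by positivity)).trans (ENNReal.ofReal_le_ofReal ?_)
    have e : ((l : ℝ) + 1) ^ 2 * ((∑ k ∈ Finset.range ⌊c r ^ j⌋₊,
        S.Ev (fun ω => (w k (X 0 ω)) ^ 2)) / (⌊c r ^ j⌋₊ : ℝ) ^ 2) =
        (∑ k ∈ Finset.range ⌊c r ^ j⌋₊, S.Ev (fun ω => (w k (X 0 ω)) ^ 2)) /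
          (1 / ((l : ℝ) + 1) * ⌊c r ^ j⌋₊) ^ 2 := by
      field_simp
    rw [e]
    exact div_le_div_of_nonneg_right (hX.Ev_max_sum_sq_le hw h0 _) (by positivity)
  filter_upwards [hae] with ω hω
  refine tendsto_max_div_of_floor_pow hb (fun n => ?_) hc1 hclim fun r => ?_
  · rw [Finset.sum_range_succ]
    linarith [hwb n (X n ω)]
  · refine Metric.tendsto_atTop'.2 fun ε hε => ?_
    obtain ⟨l, hl⟩ := exists_nat_one_div_lt hε
    obtain ⟨J, hJ⟩ := eventually_atTop.1 (hω r l)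
    refine ⟨J, fun j hj => ?_⟩
    have hpos : (0 : ℝ) < ⌊c r ^ j⌋₊ := by exact_mod_cast one_le_floor_pow (hc1 r) j
    have hlt := lt_of_pow_lt_pow_left₀ 2 (by positivity) (not_le.1 (hJ j hj.le))
    rw [Real.dist_eq, sub_zero, abs_of_nonneg (by positivity), div_lt_iff₀ hpos]
    exact hlt.trans (by gcongr)

theorem IsIID.ae_eventually_abs_le (hX : S.IsIID X)
    (h : Summable fun i : ℕ => S.Ev fun ω => clamp 0 1 (|X 0 ω| - i)) :
    ∀ᵐ ω ∂(capOuter hm hc), ∀ᶠ k : ℕ in atTop, |X k ω| ≤ k + 1 := by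
  have : ∀ᵐ ω ∂(capOuter hm hc), ∀ᶠ k : ℕ in atTop, ω ∉ {ω | (k : ℝ) + 1 ≤ |X k ω|} := by
    refine ae_eventually_notMem
      ((ENNReal.tsum_le_tsum fun k => ?_).trans_lt h.tsum_ofReal_lt_top).ne
    rw [← hX.Ev_comp_eq k (boundedLip_clamp_abs_sub k)]
    refine capOuter_le (BoundedLip_L1_one (hX.mem k) (boundedLip_clamp_abs_sub k))
      (fun ω => (clamp_mem zero_le_one _).1) fun ω hω => ?_
    exact le_max_of_le_right (le_min (by linarith [show (k : ℝ) + 1 ≤ |X k ω| from hω]) le_rfl)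
  filter_upwards [this] with ω hω
  filter_upwards [hω] with k hk
  exact (not_le.1 hk).le

theorem clamp_sq_le {c k : ℝ} (x : ℝ) (hc : 0 ≤ c) (hk : 0 ≤ k) :
    (clamp (-c) k x) ^ 2 ≤ (min |x| k) ^ 2 + c ^ 2 := by
  rcases le_total 0 x with hx | hx
  · rw [abs_of_nonneg hx, clamp, max_eq_right (by linarith [le_min hx hk])]
    nlinarith
  · have h1 : clamp (-c) k x ≤ 0 := max_le (by linarith) ((min_le_left _ _).trans hx)
    have h2 : -c ≤ clamp (-c) k x := le_max_left _ _
    nlinarith [sq_nonneg (min |x| k)]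

theorem clamp_le_add_max (c k x : ℝ) : clamp (-c) k x ≤ x + max (|x| - c) 0 := by
  refine max_le ?_ ?_
  · have := le_max_left (|x| - c) 0
    have := neg_abs_le x
    linarith
  · exact (min_le_left _ _).trans (le_add_of_nonneg_right (le_max_right _ _))

/-- The truncation is asymmetric. The fixed lower level `-c` bounds the increments below and raises
the upper expectation by at most `E[(|X| - c)⁺]`; the upper level `k + 1` is eventually not
exceeded. -/
theorem IsIID.ae_eventually_sum_le_add (hX : S.IsIID X)
    (hq : Summable fun i : ℕ => S.Ev fun ω => clamp 0 1 (|X 0 ω| - i)) (hL : S.L1 (X 0))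
    {s : ℝ} (hs : |s| = 1) (c : ℕ) :
    ∀ᵐ ω ∂(capOuter hm hc), ∀ ε > 0, ∀ᶠ n : ℕ in atTop, s * partialSum X n ω ≤
      (S.Ev (fun ω => s * X 0 ω) + S.Ev (fun ω => max (|X 0 ω| - c) 0) + ε) * n := by
  set a := S.Ev (fun ω => s * X 0 ω) + S.Ev (fun ω => max (|X 0 ω| - c) 0) with ha
  set w : ℕ → ℝ → ℝ := fun k x => clamp (-c) (k + 1) (s * x) - a with hw
  have habs : ∀ x, |s * x| = |x| := fun x => by rw [abs_mul, hs, one_mul]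
  have hsLip : LipschitzWith 1 fun x : ℝ => s * x := LipschitzWith.of_dist_le_mul fun x y => by
    rw [Real.dist_eq, Real.dist_eq, ← mul_sub, habs, NNReal.coe_one, one_mul]
  have hcl : ∀ k : ℕ, BoundedLip fun x => clamp (-(c : ℝ)) (k + 1) (s * x) := fun k =>
    (boundedLip_clamp (by linarith [c.cast_nonneg (α := ℝ), k.cast_nonneg (α := ℝ)])).comp hsLip
  have hwBL : ∀ k, BoundedLip (w k) := fun k => (hcl k).sub (BoundedLip.const a)
  have hw0 : ∀ k, S.Ev (fun ω => w k (X 0 ω)) ≤ 0 := fun k => by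
    have h1 : S.Ev (fun ω => clamp (-(c : ℝ)) (k + 1) (s * X 0 ω)) ≤ a :=
      (Ev_mono (BoundedLip_L1_one (hX.mem 0) (hcl k)) ((hL.const_mul s).add (hL.max_abs_sub c))
        fun ω => by simpa only [habs] using
          clamp_le_add_max c (k + 1) (s * X 0 ω)).trans
        (Ev_add_le (hL.const_mul s) (hL.max_abs_sub c))
    simp only [hw, sub_eq_add_neg]
    rw [Ev_add_const (BoundedLip_L1_one (hX.mem 0) (hcl k))]
    linarith
  have hq0 : ∀ i : ℕ, 0 ≤ S.Ev fun ω => clamp 0 1 (|X 0 ω| - i) := fun i =>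
    Ev_nonneg (BoundedLip_L1_one (hX.mem 0) (boundedLip_clamp_abs_sub i))
      fun ω => (clamp_mem zero_le_one _).1
  -- From `w² ≤ 2 clamp² + 2 a²` and `clamp² ≤ min(|x|, k+1)² + c²`, only the layer sum of the
  -- minimum and a constant remain.
  have hsum : Summable fun k : ℕ => S.Ev (fun ω => (w k (X 0 ω)) ^ 2) / (k + 1 : ℝ) ^ 2 := by
    have hpi : Summable fun k : ℕ => (2 * (c : ℝ) ^ 2 + 2 * a ^ 2) * (1 / ((k : ℝ) + 1) ^ 2) := by
      have := (summable_nat_add_iff 1).2 (Real.summable_one_div_nat_pow.2 one_lt_two)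
      push_cast at this
      exact this.mul_left _
    have hall := ((summable_weighted_div_sq hq0 hq).mul_left 2).add hpi
    refine Summable.of_nonneg_of_le (fun k => div_nonneg (Ev_nonneg
      (BoundedLip_L1_one (hX.mem 0) (hwBL k).sq) fun ω => sq_nonneg _) (by positivity))
      (fun k => ?_) hall
    have hLi : ∀ i : ℕ, S.L1 fun ω => (2 * i + 1 : ℝ) * clamp 0 1 (|X 0 ω| - i) := fun i =>
      (BoundedLip_L1_one (hX.mem 0) (boundedLip_clamp_abs_sub i)).const_mul _
    have hLs := L1.sum (Finset.range (k + 1)) fun i _ => hLi i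
    have hle : S.Ev (fun ω => (w k (X 0 ω)) ^ 2) ≤
        2 * ∑ i ∈ Finset.range (k + 1), (2 * i + 1) * S.Ev (fun ω => clamp 0 1 (|X 0 ω| - i)) +
          (2 * (c : ℝ) ^ 2 + 2 * a ^ 2) := by
      refine (Ev_mono (BoundedLip_L1_one (hX.mem 0) (hwBL k).sq) ((hLs.const_mul 2).add
        (L1.const (2 * (c : ℝ) ^ 2 + 2 * a ^ 2))) fun ω => ?_).trans ?_
      · have h1 := clamp_sq_le (k := k + 1) (s * X 0 ω) c.cast_nonneg (by positivity)
        have h2 := min_sq_le_sum_clamp (abs_nonneg (X 0 ω)) (k + 1)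
        rw [habs] at h1
        push_cast at h2
        simp only [hw]
        nlinarith [sq_nonneg (clamp (-(c : ℝ)) (k + 1) (s * X 0 ω) + a)]
      · rw [Ev_add_const (hLs.const_mul 2), Ev_const_mul hLs zero_le_two]
        gcongr
        refine (Ev_sum_le _ fun i _ => hLi i).trans (Finset.sum_le_sum fun i _ => ?_)
        rw [Ev_const_mul (BoundedLip_L1_one (hX.mem 0) (boundedLip_clamp_abs_sub i))
          (by positivity)]
    refine (div_le_div_of_nonneg_right hle (by positivity)).trans (le_of_eq ?_)
    ring
  have hae := hX.ae_tendsto_max_sum_div (hm := hm) (hc := hc) hwBL hw0 (b := c + |a|)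
    (by positivity) (fun k x => ?_) hsum
  · filter_upwards [hae, hX.ae_eventually_abs_le (hm := hm) (hc := hc) hq] with ω hω hω' ε hε
    obtain ⟨K, hK⟩ := eventually_atTop.1 hω'
    -- Past `K` the upper truncation is inactive and the lower one only raises values, so this
    -- discrepancy no longer increases and is negligible after division by `n`.
    set D : ℕ → ℝ := fun n =>
      s * partialSum X n ω - ∑ k ∈ Finset.range n, w k (X k ω) - a * n with hD
    have hDle : ∀ n ≥ K, D n ≤ D K := fun n hn => by
      induction n, hn using Nat.le_induction with
      | base => exact le_rfl
      | succ n hn ih =>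
        refine le_trans ?_ ih
        simp only [hD, partialSum_succ, Finset.sum_range_succ]
        have h1 : s * X n ω ≤ clamp (-c) (n + 1) (s * X n ω) := by
          refine le_max_of_le_right (le_min le_rfl ?_)
          exact (le_abs_self _).trans ((habs _).trans_le (hK n hn))
        push_cast
        simp only [hw]
        linarith
    have hev := (tendsto_order.1 hω).2 (ε / 2) (by positivity)
    filter_upwards [hev, eventually_ge_atTop K, eventually_gt_atTop 0,
      eventually_ge_atTop ⌈2 * D K / ε⌉₊] with n h1 h2 h3 h4
    have hn : (0 : ℝ) < n := by exact_mod_cast h3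
    rw [div_lt_iff₀ hn] at h1
    have h5 := Nat.ceil_le.1 h4
    rw [div_le_iff₀ hε] at h5
    have h6 := hDle n h2
    have h7 := le_max_left (∑ k ∈ Finset.range n, w k (X k ω)) 0
    have h8 : D n = s * partialSum X n ω - ∑ k ∈ Finset.range n, w k (X k ω) - a * n := rfl
    linarith
  · have h1 : -(c : ℝ) ≤ clamp (-c) (k + 1) (s * x) := le_max_left _ _
    simp only [hw]
    linarith [le_abs_self a]

/-- One half of the strong law of large numbers, for `s = 1` and `s = -1`. -/
theorem IsIID.ae_eventually_sum_le (hX : S.IsIID X)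
    (hq : Summable fun i : ℕ => S.Ev fun ω => clamp 0 1 (|X 0 ω| - i)) (hL : S.L1 (X 0))
    {s : ℝ} (hs : |s| = 1) :
    ∀ᵐ ω ∂(capOuter hm hc), ∀ ε > 0, ∀ᶠ n : ℕ in atTop,
      s * (partialSum X n ω / n) ≤ S.Ev (fun ω => s * X 0 ω) + ε := by
  have hall := ae_all_iff.2 fun c => hX.ae_eventually_sum_le_add (hm := hm) (hc := hc) hq hL hs c
  filter_upwards [hall] with ω hω ε hε
  obtain ⟨c, hcε⟩ := ((tendsto_order.1 (tendsto_Ev_max_abs_sub hc hL)).2 (ε / 2)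
    (by positivity)).exists
  filter_upwards [hω c (ε / 2) (by positivity), eventually_gt_atTop 0] with n h1 h2
  have hn : (0 : ℝ) < n := by exact_mod_cast h2
  rw [← mul_div_assoc, div_le_iff₀ hn]
  refine h1.trans (mul_le_mul_of_nonneg_right ?_ hn.le)
  linarith

/-- The strong law of large numbers: if the Choquet integral of `|X₁|` is finite then quasi-surely
`-𝔼[-X₁] ≤ lim inf Sₙ / n ≤ lim sup Sₙ / n ≤ 𝔼[X₁]`. -/
theorem IsIID.capacity_eq_zero (hm : S.IsMonotoneClass) (hc : S.IsContinuous) (hX : S.IsIID X)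
    (h : S.choquet (fun ω => |X 0 ω|) < ⊤) :
    S.capacity
      ({ω | liminf (fun n : ℕ => ((partialSum X n ω / n : ℝ) : EReal)) atTop < S.lowerE (X 0)} ∪
        {ω | S.E (X 0) < limsup (fun n : ℕ => ((partialSum X n ω / n : ℝ) : EReal)) atTop}) = 0 := by
  have hq := summable_Ev_clamp hm hc (hX.mem 0) h
  have hL := L1_of_summable hc (hX.mem 0) hq
  rw [← capOuter_eq_zero_iff (hm := hm) (hc := hc)]
  have hup := hX.ae_eventually_sum_le (hm := hm) (hc := hc) hq hL (s := 1) (by simp)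
  have hlow := hX.ae_eventually_sum_le (hm := hm) (hc := hc) hq hL (s := -1) (by simp)
  have hE := hL.coe_Ev
  have hE' : S.lowerE (X 0) = ((-S.Ev fun ω => -1 * X 0 ω : ℝ) : EReal) := by
    rw [EReal.coe_neg, (hL.const_mul (-1)).coe_Ev, lowerE]
    congr 2
    ext ω
    simp
  have hae : ∀ᵐ ω ∂(capOuter hm hc),
      ω ∉ {ω | liminf (fun n : ℕ => ((partialSum X n ω / n : ℝ) : EReal)) atTop < S.lowerE (X 0)} ∪
        {ω | S.E (X 0) < limsup (fun n : ℕ => ((partialSum X n ω / n : ℝ) : EReal)) atTop} := by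
    filter_upwards [hup, hlow] with ω h1 h2
    rintro (hω | hω)
    · have hω' : liminf (fun n : ℕ => ((partialSum X n ω / n : ℝ) : EReal)) atTop <
        S.lowerE (X 0) := hω
      rw [hE'] at hω'
      obtain ⟨r, hr1, hr2⟩ := EReal.lt_iff_exists_real_btwn.1 hω'
      refine hr1.not_ge (le_liminf_of_le (by isBoundedDefault) ?_)
      have hr := EReal.coe_lt_coe_iff.1 hr2
      filter_upwards [h2 _ (sub_pos.2 hr)] with n hn
      exact EReal.coe_le_coe_iff.2 (by linarith)
    · have hω' : S.E (X 0) <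
        limsup (fun n : ℕ => ((partialSum X n ω / n : ℝ) : EReal)) atTop := hω
      rw [← hE] at hω'
      obtain ⟨r, hr1, hr2⟩ := EReal.lt_iff_exists_real_btwn.1 hω'
      refine hr2.not_ge (limsup_le_of_le (by isBoundedDefault) ?_)
      have hr := EReal.coe_lt_coe_iff.1 hr1
      filter_upwards [h1 _ (sub_pos.2 hr)] with n hn
      simp only [one_mul] at hn
      exact EReal.coe_le_coe_iff.2 (by linarith)
  have hnull := ae_iff.1 hae
  simp only [not_not] at hnull
  exact hnull

end SublinearExpectation

theorem corollary3 {Ω : Type*} (S : SublinearExpectation Ω)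
    (hmono : S.IsMonotoneClass) (hcont : S.IsContinuous)
    (X : ℕ → Ω → ℝ) (hX : S.IsIID X) :
    (S.capacity {ω | limsup (fun n : ℕ => ((|partialSum X n ω| / n : ℝ) : EReal)) atTop = ⊤} < 1 →
      S.choquet (fun ω => |X 0 ω|) < ⊤) ∧
    (S.choquet (fun ω => |X 0 ω|) < ⊤ →
      S.capacity
        ({ω | liminf (fun n : ℕ => ((partialSum X n ω / n : ℝ) : EReal)) atTop < S.lowerE (X 0)} ∪
          {ω | S.E (X 0) < limsup (fun n : ℕ => ((partialSum X n ω / n : ℝ) : EReal)) atTop})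
        = 0) :=
  ⟨hX.choquet_lt_top hmono hcont, hX.capacity_eq_zero hmono hcont⟩
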